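/- **Pure types, domains, terms.** The pure types $P,Q$ are the closed expressions generated by $\mathtt{Unit}$, $P\times Q$, $Q\to P$, $P+Q$, type variables $\alpha$ and $\mathrm{rec}\,\alpha.P$. Let $[\![P]\!]$ be the cpos (posets with a least element and all directed suprema) given by the canonical (bilimit of embedding-projection pairs) simultaneous solution of the domain equations: $[\![\mathtt{Unit}]\!]\cong\{\bot<\top\}$; $[\![P\times Q]\!]\cong[\![P]\!]\times[\![Q]\!]$; $[\![Q\to P]\!]\cong$ the Scott-continuous functions $[\![Q]\!]\to[\![P]\!]$ with the pointwise order; $[\![P+Q]\!]\cong$ the disjoint union of $[\![P]\!]$ and $[\![Q]\!]$ with a new least element; $[\![\mathrm{rec}\,\alpha.P]\!]\cong[\![P[\mathrm{rec}\,\alpha.P/\alpha]]\!]$ (via $\mathrm{fold}$, $\mathrm{unfold}$). Terms are $\langle\rangle$, $\langle M,N\rangle$, $\pi_i(M)$, $x$, $\lambda x.M$, $MN$, $\mathrm{fix}\,x.M$, $\mathrm{fold}(M)$, $\mathrm{unfold}(M)$, $\mathrm{in}_i(M)$, $\mathrm{case}\ M\,[x_1\mapsto N_1\mid x_2\mapsto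 N_2]$, with the usual typing rules $x_1:P_1,\dots,x_n:P_n\vdash M:P$ (where $\Gamma,x:P\vdash M:P$ gives $\Gamma\vdash\mathrm{fix}\,x.M:P$) and the usual Scott-continuous interpretation $[\![M]\!]:[\![P_1]\!]\times\dots\times[\![P_n]\!]\to[\![P]\!]$: $[\![\langle\rangle]\!]=\top$, $\mathrm{fix}$ is the least fixpoint $\bigvee_k f^k(\bot)$, and $\mathrm{case}$ is $\bot$ on $\bot$. **Formulae.** Iteration terms are $t::=k\mid 0\mid t+1$, with $k$ an iteration variable. The formulae of type $P$ are generated by: $\top$, $\bot$, $\varphi\wedge\psi$, $\varphi\vee\psi$ and fixpoint variables $p$ at each type; $\langle\rangle$ at $\mathtt{Unit}$; $\langle m\rangle\varphi$ for $m\in\{\pi_1,\pi_2\}$ (at $P_1\times P_2$, $\varphi$ of type $P_i$), $m\in\{\mathrm{in}_1,\mathrm{in}_2\}$ (at $P_1+P_2$, $\varphi$ of type $P_i$), $m=\mathrm{fold}$ (at $\mathrm{rec}\,\alpha.P$, $\varphi$ of type $P[\mathrm{rec}\,\alpha.P/\alpha]$); bounded iterations $(\mu^t p)\varphi$, $(\nu^t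 p)\varphi$; quantifiers $(\exists k)\varphi$, $(\forall k)\varphi$ over iteration variables; and $\psi\Rightarrow\varphi$ at $Q\to P$, with $\psi$ of type $Q$ and $\varphi$ of type $P$ without free fixpoint variables. The languages $\mathcal L^{s}$, $s\in\{\pm,+,-\}$, are the formulae such that: $\exists$ occurs only in $\mathcal L^+$ and applied to a formula of $\mathcal L^+$ in which $k$ is positive; $\forall$ occurs only in $\mathcal L^-$ and applied to a formula of $\mathcal L^-$ in which $k$ is negative; $\psi\Rightarrow\varphi\in\mathcal L^s$ iff $\psi\in\mathcal L^{-s}$, $\varphi\in\mathcal L^s$ (with $-(\pm)=\pm$); all other constructors preserve $\mathcal L^s$. Here $k$ is positive (negative) in each formula in which it is not free; positivity and negativity are preserved by $\wedge,\vee,\langle m\rangle$; $k$ is positive (negative) in $\psi\Rightarrow\varphi$ if it is negative (positive) in $\psi$ and positive (negative) in $\varphi$; positivity is preserved by $\exists$, $\mu^t$, and by $\nu^t$ if $k\notin t$; negativity is preserved by $\forall$, $\nu^t$, and by $\mu^t$ if $k\notin t$. The *conjunctive fragment* $\mathcal L^\wedge$ consists of the formulae built from $\top,\bot,\wedge,\langle\rangle,\langle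 m\rangle,\Rightarrow$ only. *Semantics* $[\![\varphi]\!]\subseteq[\![P]\!]$: $\top,\bot,\wedge,\vee$ are the whole set, $\emptyset$, $\cap$, $\cup$; $[\![\langle\rangle]\!]=\{\top\}$; $[\![\langle\pi_i\rangle\varphi]\!]=\{x\mid x_i\in[\![\varphi]\!]\}$; $[\![\langle\mathrm{in}_i\rangle\varphi]\!]=\{\mathrm{in}_i(x)\mid x\in[\![\varphi]\!]\}$; $[\![\langle\mathrm{fold}\rangle\varphi]\!]=\{x\mid\mathrm{unfold}(x)\in[\![\varphi]\!]\}$; $[\![\psi\Rightarrow\varphi]\!]=\{f\mid\forall x\in[\![\psi]\!],\ f(x)\in[\![\varphi]\!]\}$; $\exists k,\forall k$ are $\bigcup_{k\in\mathbb N},\bigcap_{k\in\mathbb N}$; $(\mu^tp)\varphi$ and $(\nu^tp)\varphi$ are the $t$-fold iterates of $S\mapsto[\![\varphi]\!](p:=S)$ from $\emptyset$ and from the whole set. **Deduction** $\psi\vdash\varphi$ (for each $s$, between formulae of $\mathcal L^s$ of the same type; all formulae in a rule are in $\mathcal L^s$, unless said otherwise; $k$ is not free in $\theta$, nor in the unquantified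 side of a rule). Identity and cut; the usual introduction and elimination rules of $\wedge,\top,\vee,\bot$; $\psi\wedge(\varphi\vee\theta)\vdash(\psi\wedge\varphi)\vee(\psi\wedge\theta)$. Modalities: $\langle\mathrm{in}_1\rangle\varphi\wedge\langle\mathrm{in}_2\rangle\psi\vdash\bot$; $\langle m\rangle$ is monotone; $\langle m\rangle\varphi_1\wedge\langle m\rangle\varphi_2\vdash\langle m\rangle(\varphi_1\wedge\varphi_2)$; $\top\vdash\langle m\rangle\top$ for $m\neq\mathrm{in}_i$; $(\forall k)\langle m\rangle\varphi\vdash\langle m\rangle(\forall k)\varphi$; $\langle m\rangle(\varphi_1\vee\varphi_2)\vdash\langle m\rangle\varphi_1\vee\langle m\rangle\varphi_2$; $\langle m\rangle\bot\vdash\bot$; $\langle m\rangle(\exists k)\varphi\vdash(\exists k)\langle m\rangle\varphi$. Quantifiers: $\psi\vdash\varphi[t/k]$ gives $\psi\vdash(\exists k)\varphi$; $\theta\wedge\varphi\vdash\psi$ gives $\theta\wedge(\exists k)\varphi\vdash\psi$; $(\exists k)(\exists\ell)\varphi\vdash(\exists k)\varphi[k/\ell]$; $\varphi[t/k]\vdash\psi$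 gives $(\forall k)\varphi\vdash\psi$; $\psi\vdash\varphi\vee\theta$ gives $\psi\vdash(\forall k)\varphi\vee\theta$; $(\forall k)\varphi[k/\ell]\vdash(\forall k)(\forall\ell)\varphi$; for $\xi\in\{\mu,\nu\}$ and $k\notin t$, $(\xi^tp)(\exists k)\varphi\vdash(\exists k)(\xi^tp)\varphi$ and $(\forall k)(\xi^tp)\varphi\vdash(\xi^tp)(\forall k)\varphi$. Iterations: $(\mu^0p)\varphi\vdash\bot$; $(\mu^tp)\varphi\vdash\psi$ gives $(\mu^{t+1}p)\varphi\vdash\varphi[\psi/p]$; $\varphi[(\mu^tp)\varphi/p]\vdash(\mu^{t+1}p)\varphi$; $\mu^t$ is monotone; $\top\vdash(\nu^0p)\varphi$; $\psi\vdash(\nu^tp)\varphi$ gives $\varphi[\psi/p]\vdash(\nu^{t+1}p)\varphi$; $(\nu^{t+1}p)\varphi\vdash\varphi[(\nu^tp)\varphi/p]$; $\nu^t$ is monotone. Implication: if $\psi'\vdash\psi$ in $\mathcal L^{-s}$ and $\varphi\vdash\varphi'$ then $\psi\Rightarrow\varphi\vdash\psi'\Rightarrow\varphi'$; $((\forall k)\psi)\Rightarrow\varphi\vdash(\exists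 k)(\psi\Rightarrow\varphi)$; $\psi\Rightarrow(\exists k)\varphi\vdash(\exists k)(\psi\Rightarrow\varphi)$ for $\psi\in\mathcal L^\pm$; $(\forall k)(\psi\Rightarrow\varphi)\vdash((\exists k)\psi)\Rightarrow\varphi$; $(\forall k)(\psi\Rightarrow\varphi)\vdash\psi\Rightarrow(\forall k)\varphi$; $(\psi\Rightarrow\varphi_1)\wedge(\psi\Rightarrow\varphi_2)\vdash\psi\Rightarrow(\varphi_1\wedge\varphi_2)$; $\top\vdash\psi\Rightarrow\top$; $(\psi_1\Rightarrow\varphi)\wedge(\psi_2\Rightarrow\varphi)\vdash(\psi_1\vee\psi_2)\Rightarrow\varphi$; $\top\vdash\bot\Rightarrow\varphi$; and for $\delta\in\mathcal L^\wedge$: $\delta\Rightarrow(\varphi_1\vee\varphi_2)\vdash(\delta\Rightarrow\varphi_1)\vee(\delta\Rightarrow\varphi_2)$, and $\delta\Rightarrow\bot\vdash\bot$ if $\mathsf C(\delta)$. The predicate $\mathsf C$ is defined simultaneously and inductively: $\mathsf C(\langle\rangle)$; $\mathsf C(\top)$; $\mathsf C(\varphi)$ gives $\mathsf C(\langle\mathrm{fold}\rangle\varphi)$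 and $\mathsf C(\langle\mathrm{in}_i\rangle\varphi)$; $\mathsf C(\varphi)$ and $\mathsf C(\psi)$ give $\mathsf C(\langle\pi_1\rangle\varphi\wedge\langle\pi_2\rangle\psi)$; $\mathsf C(\psi)$ and $\psi\vdash\varphi$ in $\mathcal L^\pm$ with $\varphi\in\mathcal L^\wedge$ give $\mathsf C(\varphi)$; and, for finite $I$, $\mathsf C(\bigwedge_{i\in I}(\psi_i\Rightarrow\varphi_i))$ if all $\mathsf C(\psi_i)$, $\mathsf C(\varphi_i)$ hold and for each $J\subseteq I$ either $\bigwedge_{j\in J}\psi_j\vdash\bot$ in $\mathcal L^\pm$ or $\mathsf C(\bigwedge_{j\in J}\varphi_j)$. **Refinement types.** $T,U::=P\mid\{P\mid\varphi\}\mid T\times U\mid U\to T$, with $\varphi$ a closed formula of type $P$ in $\mathcal L^\pm\cup\mathcal L^+\cup\mathcal L^-$. Write $|T|$ and $|\Gamma|$ for the underlying pure type and context. $[\![T]\!]\subseteq[\![|T|]\!]$ is given by $[\![P]\!]$, $[\![\{P\mid\varphi\}]\!]=[\![\varphi]\!]$, $[\![T\times U]\!]=[\![T]\!]\times[\![U]\!]$,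 $[\![U\to T]\!]=\{f\mid\forall x\in[\![U]\!],\ f(x)\in[\![T]\!]\}$. *Subtyping* (between types with the same underlying pure type) is the least preorder with: $T\preceq|T|$; $P\preceq\{P\mid\top\}$; $\{P\mid\psi\}\preceq\{P\mid\varphi\}$ if $\psi\vdash\varphi$; $\times$ covariant; $\to$ contravariant on the left and covariant on the right; and, in both directions, $\{P\mid\varphi\}\times\{Q\mid\psi\}\simeq\{P\times Q\mid\langle\pi_1\rangle\varphi\wedge\langle\pi_2\rangle\psi\}$ and $\{Q\mid\psi\}\to\{P\mid\varphi\}\simeq\{Q\to P\mid\psi\Rightarrow\varphi\}$. *Typing* $\Gamma\vdash M:T$ is derived by: the usual rules for variables, $\lambda$, application, pairs and projections, over refinement types; $\Gamma\vdash M:P$ if $|\Gamma|\vdash M:P$; if $\Gamma\vdash M:T$, $T\preceq T'$ and $\Gamma'\preceq\Gamma$ componentwise, then $\Gamma'\vdash M:T'$; $\Gamma\vdash\langle\rangle:\{\mathtt{Unit}\mid\langle\rangle\}$; $\Gamma\vdash M_i:\{P_i\mid\varphi\}$ and $|\Gamma|\vdash M_{3-i}:P_{3-i}$ give $\Gamma\vdash\langle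 M_1,M_2\rangle:\{P_1\times P_2\mid\langle\pi_i\rangle\varphi\}$; $\Gamma\vdash M:\{P_1\times P_2\mid\langle\pi_i\rangle\varphi\}$ gives $\Gamma\vdash\pi_i(M):\{P_i\mid\varphi\}$; $M:\{P[\mathrm{rec}\,\alpha.P/\alpha]\mid\varphi\}$ gives $\mathrm{fold}(M):\{\mathrm{rec}\,\alpha.P\mid\langle\mathrm{fold}\rangle\varphi\}$ and $M:\{\mathrm{rec}\,\alpha.P\mid\langle\mathrm{fold}\rangle\varphi\}$ gives $\mathrm{unfold}(M):\{P[\mathrm{rec}\,\alpha.P/\alpha]\mid\varphi\}$; $M:\{P_i\mid\varphi\}$ gives $\mathrm{in}_i(M):\{P_1+P_2\mid\langle\mathrm{in}_i\rangle\varphi\}$; $\Gamma\vdash M:\{P_1+P_2\mid\langle\mathrm{in}_i\rangle\psi\}$, $\Gamma,x_i:\{P_i\mid\psi\}\vdash N_i:T$ and $|\Gamma|,x_{3-i}:P_{3-i}\vdash N_{3-i}:|T|$ give $\Gamma\vdash\mathrm{case}\ M\,[x_1\mapsto N_1\mid x_2\mapsto N_2]:T$; $\Gamma\vdash\mathrm{fix}\,x.M:\{P\mid\psi\}$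 and $\Gamma,x:\{P\mid\psi\}\vdash M:\{P\mid\varphi\}$ give $\Gamma\vdash\mathrm{fix}\,x.M:\{P\mid\varphi\}$; $M:\{P\mid\varphi\}$ and $M:\{P\mid\psi\}$ give $M:\{P\mid\varphi\wedge\psi\}$; $\Gamma\vdash M:T$ if $|\Gamma|\vdash M:|T|$ and $\Gamma$ contains some $x:\{Q\mid\bot\}$; and $\Gamma,x:\{Q\mid\psi_1\vee\psi_2\},\Gamma'\vdash M:T$ if the same judgement holds with $\psi_1$ and with $\psi_2$ in place of $\psi_1\vee\psi_2$. A judgement $\Gamma\vdash M:T$ with $\Gamma=x_1:U_1,\dots,x_n:U_n$ is *sound* if $|\Gamma|\vdash M:|T|$ is derivable and $[\![M]\!](u_1,\dots,u_n)\in[\![T]\!]$ for all $u_1\in[\![U_1]\!],\dots,u_n\in[\![U_n]\!]$. **Theorem.** Let $\Gamma\vdash M:T$ be a judgement all of whose formulae (in the types of $\Gamma$ and in $T$) belong to the conjunctive fragment $\mathcal L^\wedge$. If $\Gamma\vdash M:T$ is sound, then it is derivable. -/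

import Mathlib

namespace FPC

noncomputable section

/-! ## Complete partial orders and Scott-continuous functions -/

/-- A cpo (poset with a least element and all directed suprema), bundled. -/
structure Cpo : Type 1 where
  carrier : Type
  [str : CompletePartialOrder carrier]

instance : CoeSort Cpo Type := ⟨Cpo.carrier⟩

instance (X : Cpo) : CompletePartialOrder X := X.str

/-- Scott-continuous functions. -/
structure SHom (X Y : Type) [CompletePartialOrder X] [CompletePartialOrder Y] where
  toFun : X → Y
  cont : ScottContinuous toFun

section Basic

variable {X Y Z W : Type} [CompletePartialOrder X] [CompletePartialOrder Y]
  [CompletePartialOrder Z] [CompletePartialOrder W]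

instance : CoeFun (SHom X Y) (fun _ => X → Y) := ⟨SHom.toFun⟩

@[ext] theorem SHom.ext {f g : SHom X Y} (h : ∀ x, f x = g x) : f = g := by
  cases f; cases g; congr; exact funext h

theorem SHom.mono (f : SHom X Y) : Monotone f := f.cont.monotone

/-- The pointwise order. -/
instance : PartialOrder (SHom X Y) where
  le f g := ∀ x, f x ≤ g x
  le_refl _ _ := le_rfl
  le_trans _ _ _ h h' x := (h x).trans (h' x)
  le_antisymm _ _ h h' := SHom.ext fun x => (h x).antisymm (h' x)

theorem SHom.directed_apply {F : Set (SHom X Y)} (hF : DirectedOn (· ≤ ·) F) (x : X) :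
    DirectedOn (· ≤ ·) ((fun f : SHom X Y => f x) '' F) := by
  rintro _ ⟨f, hf, rfl⟩ _ ⟨g, hg, rfl⟩
  obtain ⟨k, hk, h1, h2⟩ := hF f hf g hg
  exact ⟨k x, ⟨k, hk, rfl⟩, h1 x, h2 x⟩

/-- Directed suprema of Scott-continuous functions are computed pointwise. -/
def SHom.dSup (F : Set (SHom X Y)) (hF : DirectedOn (· ≤ ·) F) : SHom X Y where
  toFun x := sSup ((fun f : SHom X Y => f x) '' F)
  cont := by
    intro d hne hd a ha
    constructor
    · rintro _ ⟨x, hx, rfl⟩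
      refine (SHom.directed_apply hF x).sSup_le ?_
      rintro _ ⟨f, hf, rfl⟩
      exact (f.mono (ha.1 hx)).trans ((SHom.directed_apply hF a).le_sSup ⟨f, hf, rfl⟩)
    · intro b hb
      refine (SHom.directed_apply hF a).sSup_le ?_
      rintro _ ⟨f, hf, rfl⟩
      refine (f.cont hne hd ha).2 ?_
      rintro _ ⟨x, hx, rfl⟩
      exact ((SHom.directed_apply hF x).le_sSup ⟨f, hf, rfl⟩).trans (hb ⟨x, hx, rfl⟩)

def SHom.const (X : Type) [CompletePartialOrder X] (y : Y) : SHom X Y :=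
  ⟨fun _ => y, ScottContinuous.const y⟩

open Classical in
instance : CompletePartialOrder (SHom X Y) where
  bot := SHom.const X ⊥
  bot_le _ _ := bot_le
  sSup F := if hF : DirectedOn (· ≤ ·) F then SHom.dSup F hF else SHom.const X ⊥
  lubOfDirected F hF := by
    rw [dif_pos hF]
    constructor
    · intro f hf x
      exact (SHom.directed_apply hF x).le_sSup ⟨f, hf, rfl⟩
    · intro g hg x
      refine (SHom.directed_apply hF x).sSup_le ?_
      rintro _ ⟨f, hf, rfl⟩
      exact hg hf x

open Classical in
theorem SHom.sSup_apply {F : Set (SHom X Y)} (hF : DirectedOn (· ≤ ·) F) (x : X) :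
    (sSup F : SHom X Y) x = sSup ((fun f : SHom X Y => f x) '' F) := by
  show (if hF : DirectedOn (· ≤ ·) F then SHom.dSup F hF else SHom.const X ⊥).toFun x = _
  rw [dif_pos hF]; rfl

def SHom.id (X : Type) [CompletePartialOrder X] : SHom X X := ⟨fun x => x, ScottContinuous.id⟩

def SHom.comp (g : SHom Y Z) (f : SHom X Y) : SHom X Z := ⟨fun x => g (f x), f.cont.comp g.cont⟩

/-- Componentwise directed suprema in the Cartesian product. -/
instance : CompletePartialOrder (X × Y) where
  sSup s := (sSup (Prod.fst '' s), sSup (Prod.snd '' s))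
  bot_le _ := bot_le
  lubOfDirected s hs := by
    have h1 : DirectedOn (· ≤ ·) (Prod.fst '' s) := by
      rintro _ ⟨a, ha, rfl⟩ _ ⟨b, hb, rfl⟩
      obtain ⟨c, hc, h, h'⟩ := hs a ha b hb
      exact ⟨c.1, ⟨c, hc, rfl⟩, h.1, h'.1⟩
    have h2 : DirectedOn (· ≤ ·) (Prod.snd '' s) := by
      rintro _ ⟨a, ha, rfl⟩ _ ⟨b, hb, rfl⟩
      obtain ⟨c, hc, h, h'⟩ := hs a ha b hb
      exact ⟨c.2, ⟨c, hc, rfl⟩, h.2, h'.2⟩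
    exact isLUB_prod.2 ⟨h1.isLUB_sSup, h2.isLUB_sSup⟩

def SHom.fst : SHom (X × Y) X := ⟨Prod.fst, ScottContinuous.fst⟩

def SHom.snd : SHom (X × Y) Y := ⟨Prod.snd, ScottContinuous.snd⟩

def SHom.pair (f : SHom Z X) (g : SHom Z Y) : SHom Z (X × Y) :=
  ⟨fun z => (f z, g z), f.cont.prodMk g.cont⟩

/-- A function of two variables is Scott-continuous if it is so in each of them. -/
theorem SHom.cont_two {f : X × Y → Z} (h1 : ∀ y, ScottContinuous fun x => f (x, y))
    (h2 : ∀ x, ScottContinuous fun y => f (x, y)) : ScottContinuous f := by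
  have hm : Monotone f := fun a b hab =>
    ((h1 a.2).monotone hab.1).trans ((h2 b.1).monotone hab.2)
  intro d hne hd a ha
  obtain ⟨ha1, ha2⟩ := isLUB_prod.1 ha
  refine ⟨?_, fun b hb => ?_⟩
  · rintro _ ⟨x, hx, rfl⟩
    exact hm (ha.1 hx)
  · have d1 : DirectedOn (· ≤ ·) (Prod.fst '' d) := by
      rintro _ ⟨a, ha, rfl⟩ _ ⟨b, hb, rfl⟩
      obtain ⟨c, hc, h, h'⟩ := hd a ha b hb
      exact ⟨c.1, ⟨c, hc, rfl⟩, h.1, h'.1⟩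
    have d2 : DirectedOn (· ≤ ·) (Prod.snd '' d) := by
      rintro _ ⟨a, ha, rfl⟩ _ ⟨b, hb, rfl⟩
      obtain ⟨c, hc, h, h'⟩ := hd a ha b hb
      exact ⟨c.2, ⟨c, hc, rfl⟩, h.2, h'.2⟩
    refine (h1 a.2 (hne.image _) d1 ha1).2 ?_
    rintro _ ⟨_, ⟨x, hx, rfl⟩, rfl⟩
    refine (h2 x.1 (hne.image _) d2 ha2).2 ?_
    rintro _ ⟨_, ⟨y, hy, rfl⟩, rfl⟩
    obtain ⟨z, hz, hxz, hyz⟩ := hd x hx y hy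
    exact (hm (show (x.1, y.2) ≤ z from ⟨hxz.1, hyz.2⟩)).trans (hb ⟨z, hz, rfl⟩)

theorem SHom.cont_apply (x : X) : ScottContinuous fun f : SHom X Y => f x := by
  rw [CompletePartialOrder.scottContinuous]
  intro F _ hF
  rw [SHom.sSup_apply hF]
  exact (SHom.directed_apply hF x).isLUB_sSup

/-- Evaluation. -/
def SHom.eval : SHom (SHom X Y × X) Y :=
  ⟨fun p => p.1 p.2, SHom.cont_two (fun x => SHom.cont_apply x) (fun f => f.cont)⟩

theorem SHom.cont_of_pointwise {f : X → SHom Y Z} (h : ∀ y, ScottContinuous fun x => f x y) :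
    ScottContinuous f := by
  intro d hne hd a ha
  constructor
  · rintro _ ⟨x, hx, rfl⟩ y
    exact (h y).monotone (ha.1 hx)
  · intro g hg y
    refine (h y hne hd ha).2 ?_
    rintro _ ⟨x, hx, rfl⟩
    exact hg ⟨x, hx, rfl⟩ y

/-- Currying. The new variable is the first component. -/
def SHom.curry (f : SHom (X × Y) Z) : SHom Y (SHom X Z) where
  toFun y := ⟨fun x => f (x, y), ((ScottContinuous.id).prodMk (ScottContinuous.const y)).comp f.cont⟩
  cont := SHom.cont_of_pointwise fun x =>
    ((ScottContinuous.const x).prodMk (ScottContinuous.id)).comp f.cont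

/-- An order isomorphism is Scott-continuous. -/
def SHom.ofIso (e : X ≃o Y) : SHom X Y := ⟨e, fun _ _ _ _ ha => e.isLUB_image'.2 ha⟩

/-- The map taking `f` to its `n`-th iterate at the least element. -/
def SHom.iter (X : Type) [CompletePartialOrder X] : ℕ → SHom (SHom X X) X
  | 0 => SHom.const _ ⊥
  | n + 1 => SHom.comp SHom.eval (SHom.pair (SHom.id _) (SHom.iter X n))

/-- The fixpoint combinator taking `f` to the supremum of its iterates at the least element. -/
def SHom.lfp (X : Type) [CompletePartialOrder X] : SHom (SHom X X) X := ⨆ n, SHom.iter X n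

/-! ### The weak sum -/

/-- The disjoint union of `X` and `Y` with a new least element. -/
inductive LSum (X Y : Type) : Type
  | bot : LSum X Y
  | inl (x : X) : LSum X Y
  | inr (y : Y) : LSum X Y

namespace LSum

def le : LSum X Y → LSum X Y → Prop
  | bot, _ => True
  | inl x, inl x' => x ≤ x'
  | inr y, inr y' => y ≤ y'
  | _, _ => False

instance : PartialOrder (LSum X Y) where
  le := le
  le_refl a := by cases a <;> simp [le]
  le_trans a b c := by
    cases a <;> cases b <;> cases c <;> simp only [le, imp_self, implies_true, false_imp_iff,
      imp_false] <;> exact fun h h' => le_trans h h'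
  le_antisymm a b := by
    cases a <;> cases b <;> simp only [le, imp_self, implies_true, false_imp_iff] <;>
      (intro h h'; rw [le_antisymm h h'])

theorem bot_le' (a : LSum X Y) : bot ≤ a := trivial
@[simp] theorem inl_le_inl {x x' : X} : (inl x : LSum X Y) ≤ inl x' ↔ x ≤ x' := Iff.rfl
@[simp] theorem inr_le_inr {y y' : Y} : (inr y : LSum X Y) ≤ inr y' ↔ y ≤ y' := Iff.rfl

theorem inl_le {x : X} {a : LSum X Y} : inl x ≤ a ↔ ∃ x', a = inl x' ∧ x ≤ x' := by
  cases a with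
  | bot => exact ⟨False.elim, by rintro ⟨_, h, _⟩; cases h⟩
  | inl x' => exact ⟨fun h => ⟨x', rfl, h⟩, by rintro ⟨_, h, h'⟩; cases h; exact h'⟩
  | inr y => exact ⟨False.elim, by rintro ⟨_, h, _⟩; cases h⟩

theorem inr_le {y : Y} {a : LSum X Y} : inr y ≤ a ↔ ∃ y', a = inr y' ∧ y ≤ y' := by
  cases a with
  | bot => exact ⟨False.elim, by rintro ⟨_, h, _⟩; cases h⟩
  | inr y' => exact ⟨fun h => ⟨y', rfl, h⟩, by rintro ⟨_, h, h'⟩; cases h; exact h'⟩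
  | inl y => exact ⟨False.elim, by rintro ⟨_, h, _⟩; cases h⟩

theorem directed_inl {D : Set (LSum X Y)} (hD : DirectedOn (· ≤ ·) D) :
    DirectedOn (· ≤ ·) {x | inl x ∈ D} := by
  intro x hx x' hx'
  obtain ⟨c, hc, h, h'⟩ := hD _ hx _ hx'
  obtain ⟨z, rfl, hz⟩ := inl_le.1 h
  exact ⟨z, hc, hz, h'⟩

theorem directed_inr {D : Set (LSum X Y)} (hD : DirectedOn (· ≤ ·) D) :
    DirectedOn (· ≤ ·) {y | inr y ∈ D} := by
  intro x hx x' hx'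
  obtain ⟨c, hc, h, h'⟩ := hD _ hx _ hx'
  obtain ⟨z, rfl, hz⟩ := inr_le.1 h
  exact ⟨z, hc, hz, h'⟩

open Classical in
instance : CompletePartialOrder (LSum X Y) where
  bot := bot
  bot_le := bot_le'
  sSup D :=
    if ∃ x, inl x ∈ D then inl (sSup {x | inl x ∈ D})
    else if ∃ y, inr y ∈ D then inr (sSup {y | inr y ∈ D})
    else bot
  lubOfDirected D hD := by
    split_ifs with h1 h2
    · obtain ⟨x, hx⟩ := h1
      constructor
      · intro a ha
        cases a with
        | bot => exact bot_le' _
        | inl x' => exact (directed_inl hD).le_sSup ha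
        | inr y =>
          obtain ⟨c, _, h, h'⟩ := hD _ hx _ ha
          obtain ⟨z, rfl, _⟩ := inl_le.1 h
          exact h'.elim
      · intro b hb
        obtain ⟨z, rfl, _⟩ := inl_le.1 (hb hx)
        exact (directed_inl hD).sSup_le fun x' hx' => hb hx'
    · obtain ⟨y, hy⟩ := h2
      constructor
      · intro a ha
        cases a with
        | bot => exact bot_le' _
        | inl x => exact (h1 ⟨x, ha⟩).elim
        | inr y' => exact (directed_inr hD).le_sSup ha
      · intro b hb
        obtain ⟨z, rfl, _⟩ := inr_le.1 (hb hy)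
        exact (directed_inr hD).sSup_le fun x' hx' => hb hx'
    · constructor
      · intro a ha
        cases a with
        | bot => exact bot_le' _
        | inl x => exact (h1 ⟨x, ha⟩).elim
        | inr y => exact (h2 ⟨y, ha⟩).elim
      · exact fun b _ => bot_le' b

/-- Copairing, strict in its argument. -/
def elim (f : X → Z) (g : Y → Z) : LSum X Y → Z
  | bot => ⊥
  | inl x => f x
  | inr y => g y

theorem inl_cont : ScottContinuous (inl : X → LSum X Y) := by
  intro d hne hd a ha
  constructor
  · rintro _ ⟨x, hx, rfl⟩
    exact ha.1 hx
  · intro b hb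
    obtain ⟨x, hx⟩ := hne
    obtain ⟨z, rfl, _⟩ := inl_le.1 (hb ⟨x, hx, rfl⟩)
    exact ha.2 fun x' hx' => hb ⟨x', hx', rfl⟩

theorem inr_cont : ScottContinuous (inr : Y → LSum X Y) := by
  intro d hne hd a ha
  constructor
  · rintro _ ⟨x, hx, rfl⟩
    exact ha.1 hx
  · intro b hb
    obtain ⟨x, hx⟩ := hne
    obtain ⟨z, rfl, _⟩ := inr_le.1 (hb ⟨x, hx, rfl⟩)
    exact ha.2 fun x' hx' => hb ⟨x', hx', rfl⟩

theorem elim_mono (f : SHom X Z) (g : SHom Y Z) : Monotone (elim f g) := by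
  intro a b h
  cases a with
  | bot => exact bot_le
  | inl x => obtain ⟨z, rfl, hz⟩ := inl_le.1 h; exact f.mono hz
  | inr x => obtain ⟨z, rfl, hz⟩ := inr_le.1 h; exact g.mono hz

theorem elim_cont (f : SHom X Z) (g : SHom Y Z) : ScottContinuous (elim f g) := by
  intro d hne hd a ha
  refine ⟨?_, fun b hb => ?_⟩
  · rintro _ ⟨x, hx, rfl⟩
    exact elim_mono f g (ha.1 hx)
  · cases a with
    | bot => exact bot_le
    | inl x =>
      have hne' : {x | inl x ∈ d}.Nonempty := by
        by_contra hcon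
        have : (inl x : LSum X Y) ≤ bot := ha.2 fun c hc => by
          cases c with
          | bot => exact le_rfl
          | inl z => exact (hcon ⟨z, hc⟩).elim
          | inr z => exact (ha.1 hc).elim
        exact this.elim
      have hl : IsLUB {x | inl x ∈ d} x := by
        refine ⟨fun z hz => ha.1 hz, fun u hu => ?_⟩
        refine inl_le_inl.1 ((isLUB_le_iff (b := inl u) ha).2 fun c hc => ?_)
        cases c with
        | bot => exact bot_le' _
        | inl z => exact hu hc
        | inr z => exact (ha.1 hc).elim
      refine (f.cont hne' (directed_inl hd) hl).2 ?_
      rintro _ ⟨z, hz, rfl⟩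
      exact hb ⟨_, hz, rfl⟩
    | inr x =>
      have hne' : {x | inr x ∈ d}.Nonempty := by
        by_contra hcon
        have : (inr x : LSum X Y) ≤ bot := ha.2 fun c hc => by
          cases c with
          | bot => exact le_rfl
          | inr z => exact (hcon ⟨z, hc⟩).elim
          | inl z => exact (ha.1 hc).elim
        exact this.elim
      have hl : IsLUB {x | inr x ∈ d} x := by
        refine ⟨fun z hz => ha.1 hz, fun u hu => ?_⟩
        refine inr_le_inr.1 ((isLUB_le_iff (b := inr u) ha).2 fun c hc => ?_)
        cases c with
        | bot => exact bot_le' _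
        | inr z => exact hu hc
        | inl z => exact (ha.1 hc).elim
      refine (g.cont hne' (directed_inr hd) hl).2 ?_
      rintro _ ⟨z, hz, rfl⟩
      exact hb ⟨_, hz, rfl⟩

end LSum

def SHom.inl : SHom X (LSum X Y) := ⟨LSum.inl, LSum.inl_cont⟩

def SHom.inr : SHom Y (LSum X Y) := ⟨LSum.inr, LSum.inr_cont⟩

def SHom.copair (f : SHom X Z) (g : SHom Y Z) : SHom (LSum X Y) Z := ⟨LSum.elim f g, LSum.elim_cont f g⟩

/-- Copairing with parameters. -/
def SHom.case (m : SHom W (LSum X Y)) (f : SHom (X × W) Z) (g : SHom (Y × W) Z) : SHom W Z where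
  toFun w := SHom.copair (f.curry w) (g.curry w) (m w)
  cont := by
    have h : ScottContinuous fun p : W × LSum X Y =>
        SHom.copair (f.curry p.1) (g.curry p.1) p.2 := by
      refine SHom.cont_two (fun a => ?_) fun w => (SHom.copair (f.curry w) (g.curry w)).cont
      cases a with
      | bot => exact ScottContinuous.const ⊥
      | inl x => exact ((ScottContinuous.const x).prodMk (ScottContinuous.id)).comp f.cont
      | inr y => exact ((ScottContinuous.const y).prodMk (ScottContinuous.id)).comp g.cont
    exact ((ScottContinuous.id).prodMk m.cont).comp h

/-! ### Embedding-projection pairs -/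

/-- An embedding-projection pair from `X` to `Y`. -/
structure EP (X Y : Type) [CompletePartialOrder X] [CompletePartialOrder Y] where
  e : SHom X Y
  p : SHom Y X
  pe : ∀ x, p (e x) = x
  ep : ∀ y, e (p y) ≤ y

theorem EP.p_bot (f : EP X Y) : f.p ⊥ = ⊥ :=
  le_bot_iff.1 ((f.p.mono (bot_le : ⊥ ≤ f.e ⊥)).trans (f.pe ⊥).le)

theorem EP.e_bot (f : EP X Y) : f.e ⊥ = ⊥ :=
  le_bot_iff.1 ((f.e.mono (bot_le : ⊥ ≤ f.p ⊥)).trans (f.ep ⊥))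

end Basic

instance : CompletePartialOrder PUnit where
  sSup _ := PUnit.unit
  lubOfDirected _ _ := ⟨fun _ _ => le_rfl, fun _ _ => le_rfl⟩

abbrev Cpo.one : Cpo := ⟨PUnit⟩
/-- The two-element domain. -/
abbrev Cpo.two : Cpo := ⟨Bool⟩
abbrev Cpo.prod (X Y : Cpo) : Cpo := ⟨X × Y⟩
abbrev Cpo.arr (X Y : Cpo) : Cpo := ⟨SHom X Y⟩
abbrev Cpo.sum (X Y : Cpo) : Cpo := ⟨LSum X Y⟩

def EP.refl (X : Cpo) : EP X X := ⟨SHom.id X, SHom.id X, fun _ => rfl, fun _ => le_rfl⟩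

/-- The one-point cpo is initial for embedding-projection pairs. -/
def EP.init (X : Cpo) : EP Cpo.one X :=
  ⟨SHom.const _ ⊥, SHom.const _ PUnit.unit, fun _ => rfl, fun _ => bot_le⟩

def EP.prod {X X' Y Y' : Cpo} (f : EP X X') (g : EP Y Y') : EP (X.prod Y) (X'.prod Y') where
  e := SHom.pair (SHom.comp f.e SHom.fst) (SHom.comp g.e SHom.snd)
  p := SHom.pair (SHom.comp f.p SHom.fst) (SHom.comp g.p SHom.snd)
  pe x := Prod.ext (f.pe x.1) (g.pe x.2)
  ep y := ⟨f.ep y.1, g.ep y.2⟩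

def EP.arr {X X' Y Y' : Cpo} (f : EP X X') (g : EP Y Y') : EP (X.arr Y) (X'.arr Y') where
  e := ⟨fun h => SHom.comp g.e (SHom.comp h f.p), SHom.cont_of_pointwise fun x =>
    (SHom.cont_apply (f.p x)).comp g.e.cont⟩
  p := ⟨fun h => SHom.comp g.p (SHom.comp h f.e), SHom.cont_of_pointwise fun x =>
    (SHom.cont_apply (f.e x)).comp g.p.cont⟩
  pe h := SHom.ext fun x => by
    show g.p (g.e (SHom.toFun h (f.p (f.e x)))) = SHom.toFun h x
    rw [g.pe, f.pe]
  ep h x := (g.ep _).trans (SHom.mono h (f.ep x))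

def EP.sum {X X' Y Y' : Cpo} (f : EP X X') (g : EP Y Y') : EP (X.sum Y) (X'.sum Y') where
  e := SHom.copair (SHom.comp SHom.inl f.e) (SHom.comp SHom.inr g.e)
  p := SHom.copair (SHom.comp SHom.inl f.p) (SHom.comp SHom.inr g.p)
  pe x := by
    cases x with
    | bot => rfl
    | inl x => exact congrArg LSum.inl (f.pe x)
    | inr x => exact congrArg LSum.inr (g.pe x)
  ep x := by
    cases x with
    | bot => exact le_rfl
    | inl x => exact f.ep x
    | inr x => exact g.ep x

/-! ### Bilimits -/

/-- An `ω`-chain of embedding-projection pairs. -/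
structure Chain : Type 1 where
  X : ℕ → Cpo
  ep : ∀ n, EP (X n) (X (n + 1))

abbrev Chain.shift (C : Chain) : Chain := ⟨fun n => C.X (n + 1), fun n => C.ep (n + 1)⟩
abbrev Chain.const (X : Cpo) : Chain := ⟨fun _ => X, fun _ => EP.refl X⟩
abbrev Chain.prod (C C' : Chain) : Chain :=
  ⟨fun n => (C.X n).prod (C'.X n), fun n => (C.ep n).prod (C'.ep n)⟩
abbrev Chain.arr (C C' : Chain) : Chain :=
  ⟨fun n => (C.X n).arr (C'.X n), fun n => (C.ep n).arr (C'.ep n)⟩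
abbrev Chain.sum (C C' : Chain) : Chain :=
  ⟨fun n => (C.X n).sum (C'.X n), fun n => (C.ep n).sum (C'.ep n)⟩

/-- The limit of the projections of a chain, which is also the colimit of its embeddings. -/
structure Lim (C : Chain) : Type where
  seq : ∀ n, C.X n
  compat : ∀ n, (C.ep n).p (seq (n + 1)) = seq n

namespace Lim

variable {C C' : Chain}

@[ext] theorem ext {x y : Lim C} (h : ∀ n, x.seq n = y.seq n) : x = y := by
  cases x; cases y; congr; exact funext h

/-- The componentwise order. -/
instance : PartialOrder (Lim C) where
  le x y := ∀ n, x.seq n ≤ y.seq n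
  le_refl _ _ := le_rfl
  le_trans _ _ _ h h' n := (h n).trans (h' n)
  le_antisymm _ _ h h' := ext fun n => (h n).antisymm (h' n)

theorem directed_seq {d : Set (Lim C)} (hd : DirectedOn (· ≤ ·) d) (n : ℕ) :
    DirectedOn (· ≤ ·) ((fun x : Lim C => x.seq n) '' d) := by
  rintro _ ⟨f, hf, rfl⟩ _ ⟨g, hg, rfl⟩
  obtain ⟨k, hk, h1, h2⟩ := hd f hf g hg
  exact ⟨_, ⟨k, hk, rfl⟩, h1 n, h2 n⟩

/-- Directed suprema are computed componentwise. -/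
def dSup (d : Set (Lim C)) (hne : d.Nonempty) (hd : DirectedOn (· ≤ ·) d) : Lim C where
  seq n := sSup ((fun x : Lim C => x.seq n) '' d)
  compat n := by
    have h := ((C.ep n).p.cont (hne.image _) (directed_seq hd (n + 1))
      (directed_seq hd (n + 1)).isLUB_sSup)
    refine h.unique ?_
    rw [Set.image_image]
    simp only [compat]
    exact (directed_seq hd n).isLUB_sSup

open Classical in
instance : CompletePartialOrder (Lim C) where
  bot := ⟨fun _ => ⊥, fun n => (C.ep n).p_bot⟩
  bot_le _ _ := bot_le
  sSup d := if h : d.Nonempty ∧ DirectedOn (· ≤ ·) d then dSup d h.1 h.2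
    else ⟨fun _ => ⊥, fun n => (C.ep n).p_bot⟩
  lubOfDirected d hd := by
    split_ifs with h
    · constructor
      · intro x hx n
        exact (directed_seq hd n).le_sSup ⟨x, hx, rfl⟩
      · intro y hy n
        refine (directed_seq hd n).sSup_le ?_
        rintro _ ⟨x, hx, rfl⟩
        exact hy hx n
    · have : d = ∅ := Set.not_nonempty_iff_eq_empty.1 fun hne => h ⟨hne, hd⟩
      subst this
      exact ⟨fun _ hx => hx.elim, fun _ _ _ => bot_le⟩

/-- Deleting the first term of a chain does not change its bilimit. -/
def shiftIso (C : Chain) : Lim C ≃o Lim C.shift where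
  toFun x := ⟨fun n => x.seq (n + 1), fun n => x.compat (n + 1)⟩
  invFun y := ⟨fun n => match n with
    | 0 => (C.ep 0).p (y.seq 0)
    | n + 1 => y.seq n, fun n => match n with
    | 0 => rfl
    | n + 1 => y.compat n⟩
  left_inv x := ext fun n => match n with
    | 0 => x.compat 0
    | _ + 1 => rfl
  right_inv _ := rfl
  map_rel_iff' {x y} := ⟨fun h n => match n with
    | 0 => by rw [← x.compat 0, ← y.compat 0]; exact (C.ep 0).p.mono (h 0)
    | n + 1 => h n, fun h n => h (n + 1)⟩

/-- The embedding of the first term of a chain into another one. -/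
def up (C : Chain) : ∀ m, SHom (C.X 0) (C.X m)
  | 0 => SHom.id _
  | m + 1 => SHom.comp (C.ep m).e (up C m)

/-- The projection of the bilimit onto a term of the chain. -/
def proj (C : Chain) (n : ℕ) : SHom (Lim C) (C.X n) where
  toFun x := x.seq n
  cont := by
    rw [CompletePartialOrder.scottContinuous]
    intro d hne hd
    have : (sSup d : Lim C) = dSup d hne hd := dif_pos ⟨hne, hd⟩
    rw [this]
    exact (directed_seq hd n).isLUB_sSup

theorem cont_of_seq {Z : Type} [CompletePartialOrder Z] {f : Z → Lim C}
    (h : ∀ n, ScottContinuous fun z => (f z).seq n) : ScottContinuous f := by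
  intro d hne hd a ha
  constructor
  · rintro _ ⟨x, hx, rfl⟩ n
    exact (h n).monotone (ha.1 hx)
  · intro g hg n
    refine (h n hne hd ha).2 ?_
    rintro _ ⟨x, hx, rfl⟩
    exact hg ⟨x, hx, rfl⟩ n

/-- The embedding of a term of the chain into the bilimit. -/
def emb : ∀ (C : Chain) (n : ℕ), SHom (C.X n) (Lim C)
  | C, 0 => ⟨fun x => ⟨fun m => up C m x, fun m => (C.ep m).pe _⟩,
      cont_of_seq fun m => (up C m).cont⟩
  | C, n + 1 => SHom.comp (SHom.ofIso (shiftIso C).symm) (emb C.shift n)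

theorem up_shift (C : Chain) (m : ℕ) (x : C.X 0) :
    up C.shift m ((C.ep 0).e x) = up C (m + 1) x := by
  induction m with
  | zero => rfl
  | succ m ih => exact congrArg (C.ep (m + 1)).e ih

theorem proj_emb (C : Chain) (n : ℕ) (x : C.X n) : (emb C n x).seq n = x := by
  induction n generalizing C with
  | zero => rfl
  | succ n ih => exact ih C.shift x

theorem emb_succ (C : Chain) (n : ℕ) (x : C.X n) : emb C (n + 1) ((C.ep n).e x) = emb C n x := by
  induction n generalizing C with
  | zero =>
    ext m
    cases m with
    | zero => exact (C.ep 0).pe x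
    | succ m => exact up_shift C m x
  | succ n ih => exact congrArg (shiftIso C).symm (ih C.shift x)

theorem emb_proj_le (C : Chain) (n : ℕ) (x : Lim C) : emb C n (x.seq n) ≤ x := by
  induction n generalizing C with
  | zero =>
    intro m
    induction m with
    | zero => exact le_rfl
    | succ m ih =>
      refine ((C.ep m).e.mono ih).trans ?_
      rw [← x.compat m]
      exact (C.ep m).ep _
  | succ n ih =>
    have h := (shiftIso C).symm.monotone (ih C.shift (shiftIso C x))
    rw [OrderIso.symm_apply_apply] at h
    exact h

theorem emb_proj_mono (x : Lim C) : Monotone fun n => emb C n (x.seq n) := by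
  refine monotone_nat_of_le_succ fun n => ?_
  rw [← emb_succ, ← x.compat n]
  exact (emb C (n + 1)).mono ((C.ep n).ep _)

theorem seq_emb_proj {m n : ℕ} (h : m ≤ n) (x : Lim C) : (emb C n (x.seq n)).seq m = x.seq m := by
  refine (emb_proj_le C n x m).antisymm ?_
  have := emb_proj_mono x h m
  rwa [proj_emb] at this

/-- Each element of a bilimit is the supremum of its projections. -/
theorem isLUB_emb_proj (x : Lim C) : IsLUB (Set.range fun n => emb C n (x.seq n)) x := by
  constructor
  · rintro _ ⟨n, rfl⟩
    exact emb_proj_le C n x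
  · intro y hy n
    have := hy ⟨n, rfl⟩ n
    rwa [proj_emb] at this

/-- The bilimit of a constant chain. -/
def constIso (X : Cpo) : X ≃o Lim (Chain.const X) :=
  RelIso.ofSurjective (r := (· ≤ ·)) (s := (· ≤ ·))
    ⟨⟨fun x => ⟨fun _ => x, fun _ => rfl⟩, fun x y h => congrArg (fun z => z.seq 0) h⟩,
      fun {x y} => ⟨fun h => h 0, fun h _ => h⟩⟩
    (by
      intro z
      refine ⟨z.seq 0, ext fun n => ?_⟩
      induction n with
      | zero => rfl
      | succ n ih => exact ih.trans (z.compat n).symm)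

/-- Bilimits commute with products. -/
def prodIso (C C' : Chain) : Lim C × Lim C' ≃o Lim (C.prod C') where
  toFun x := ⟨fun n => (x.1.seq n, x.2.seq n), fun n => Prod.ext (x.1.compat n) (x.2.compat n)⟩
  invFun z := (⟨fun n => (z.seq n).1, fun n => congrArg Prod.fst (z.compat n)⟩,
    ⟨fun n => (z.seq n).2, fun n => congrArg Prod.snd (z.compat n)⟩)
  left_inv _ := rfl
  right_inv _ := rfl
  map_rel_iff' := ⟨fun h => ⟨fun n => (h n).1, fun n => (h n).2⟩, fun h n => ⟨h.1 n, h.2 n⟩⟩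

def ofSum (C C' : Chain) : LSum (Lim C) (Lim C') → Lim (C.sum C')
  | .bot => ⟨fun _ => .bot, fun _ => rfl⟩
  | .inl x => ⟨fun n => .inl (x.seq n), fun n => congrArg LSum.inl (x.compat n)⟩
  | .inr y => ⟨fun n => .inr (y.seq n), fun n => congrArg LSum.inr (y.compat n)⟩

theorem ofSum_le (C C' : Chain) (a b : LSum (Lim C) (Lim C')) :
    ofSum C C' a ≤ ofSum C C' b ↔ a ≤ b := by
  cases a <;> cases b
  case inl.inl => exact Iff.rfl
  case inr.inr => exact Iff.rfl
  case bot.bot => exact ⟨fun _ => trivial, fun _ _ => trivial⟩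
  case bot.inl => exact ⟨fun _ => trivial, fun _ _ => trivial⟩
  case bot.inr => exact ⟨fun _ => trivial, fun _ _ => trivial⟩
  all_goals exact ⟨fun h => (h 0).elim, fun h => h.elim⟩

theorem ofSum_surj (C C' : Chain) : Function.Surjective (ofSum C C') := by
  intro z
  have tag : ∀ n (a : (C.X (n + 1)).sum (C'.X (n + 1))) (b : (C.X n).sum (C'.X n)),
      ((C.sum C').ep n).p a = b →
      (a = LSum.bot ∧ b = LSum.bot) ∨ (∃ x y, a = LSum.inl x ∧ b = LSum.inl y) ∨
      (∃ x y, a = LSum.inr x ∧ b = LSum.inr y) := by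
    rintro n (_ | x | x) _ rfl
    · exact Or.inl ⟨rfl, rfl⟩
    · exact Or.inr (Or.inl ⟨x, _, rfl, rfl⟩)
    · exact Or.inr (Or.inr ⟨x, _, rfl, rfl⟩)
  rcases h0 : z.seq 0 with _ | x | x
  · have h : ∀ n, z.seq n = LSum.bot := by
      intro n
      induction n with
      | zero => exact h0
      | succ n ih =>
        rcases tag n _ _ (z.compat n) with h | ⟨_, _, _, h⟩ | ⟨_, _, _, h⟩
        · exact h.1
        · rw [ih] at h; cases h
        · rw [ih] at h; cases h
    exact ⟨.bot, ext fun n => (h n).symm⟩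
  · have h : ∀ n, ∃ y, z.seq n = LSum.inl y := by
      intro n
      induction n with
      | zero => exact ⟨x, h0⟩
      | succ n ih =>
        obtain ⟨y, ih⟩ := ih
        rcases tag n _ _ (z.compat n) with h | ⟨u, _, h, _⟩ | ⟨_, _, _, h⟩
        · rw [ih] at h; cases h.2
        · exact ⟨u, h⟩
        · rw [ih] at h; cases h
    choose y hy using h
    refine ⟨.inl ⟨y, fun n => ?_⟩, ext fun n => (hy n).symm⟩
    have := z.compat n
    rw [hy, hy] at this
    exact LSum.inl.inj this
  · have h : ∀ n, ∃ y, z.seq n = LSum.inr y := by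
      intro n
      induction n with
      | zero => exact ⟨x, h0⟩
      | succ n ih =>
        obtain ⟨y, ih⟩ := ih
        rcases tag n _ _ (z.compat n) with h | ⟨_, _, _, h⟩ | ⟨u, _, h, _⟩
        · rw [ih] at h; cases h.2
        · rw [ih] at h; cases h
        · exact ⟨u, h⟩
    choose y hy using h
    refine ⟨.inr ⟨y, fun n => ?_⟩, ext fun n => (hy n).symm⟩
    have := z.compat n
    rw [hy, hy] at this
    exact LSum.inr.inj this

/-- Bilimits commute with weak sums. -/
def sumIso (C C' : Chain) : LSum (Lim C) (Lim C') ≃o Lim (C.sum C') :=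
  RelIso.ofSurjective (r := (· ≤ ·)) (s := (· ≤ ·))
    ⟨⟨ofSum C C', fun a b h => le_antisymm ((ofSum_le C C' a b).1 h.le)
      ((ofSum_le C C' b a).1 h.ge)⟩, fun {a b} => ofSum_le C C' a b⟩ (ofSum_surj C C')

theorem arr_mono (f : Lim (C.arr C')) (x : Lim C) :
    Monotone fun n => emb C' n ((SHom.toFun (f.seq n)) (x.seq n)) := by
  refine monotone_nat_of_le_succ fun n => ?_
  have h : (SHom.toFun (f.seq n)) (x.seq n) =
      (C'.ep n).p ((SHom.toFun (f.seq (n + 1))) ((C.ep n).e (x.seq n))) := by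
    conv_lhs => rw [← f.compat n]
    rfl
  show emb C' n ((SHom.toFun (f.seq n)) (x.seq n)) ≤ _
  rw [h, ← emb_succ]
  refine (emb C' (n + 1)).mono (((C'.ep n).ep _).trans (SHom.mono _ ?_))
  rw [← x.compat n]
  exact (C.ep n).ep _

/-- The Scott-continuous function given by a compatible family of functions. -/
def toHom (f : Lim (C.arr C')) : SHom (Lim C) (Lim C') :=
  ⨆ n, SHom.comp (emb C' n) (SHom.comp (f.seq n) (proj C n))

theorem isLUB_toHom (f : Lim (C.arr C')) (x : Lim C) :
    IsLUB (Set.range fun n => emb C' n ((SHom.toFun (f.seq n)) (x.seq n))) (toHom f x) := by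
  have hm : Monotone fun n => SHom.comp (emb C' n) (SHom.comp (f.seq n) (proj C n)) :=
    fun _ _ h x => arr_mono f x h
  have hd := hm.directed_le.directedOn_range
  have h : toHom f x = sSup _ := SHom.sSup_apply hd x
  rw [h]
  have h' := (SHom.directed_apply hd x).isLUB_sSup
  rw [← Set.range_comp] at h' ⊢
  exact h'

/-- The compatible family of functions given by a Scott-continuous function. -/
def ofHom (g : SHom (Lim C) (Lim C')) : Lim (C.arr C') where
  seq n := SHom.comp (proj C' n) (SHom.comp g (emb C n))
  compat n := SHom.ext fun x => by
    show (C'.ep n).p ((g (emb C (n + 1) ((C.ep n).e x))).seq (n + 1)) = (g (emb C n x)).seq n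
    rw [emb_succ, (g (emb C n x)).compat n]

theorem ofHom_toHom (f : Lim (C.arr C')) : ofHom (toHom f) = f := by
  refine ext fun n => SHom.ext fun x => ?_
  have key : ∀ k, n ≤ k →
      (emb C' k ((SHom.toFun (f.seq k)) ((emb C n x).seq k))).seq n = (SHom.toFun (f.seq n)) x := by
    intro k hk
    induction k, hk using Nat.le_induction with
    | base => rw [proj_emb, proj_emb]
    | succ k hk ih =>
      have h1 : emb C k ((emb C n x).seq k) = emb C n x := by
        refine (emb_proj_le C k _).antisymm ?_
        have := emb_proj_mono (emb C n x) hk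
        simpa only [proj_emb] using this
      have h2 : (emb C n x).seq (k + 1) = (C.ep k).e ((emb C n x).seq k) := by
        conv_lhs => rw [← h1, ← emb_succ, proj_emb]
      have h3 : ∀ z, (emb C' (k + 1) z).seq n = (emb C' k ((C'.ep k).p z)).seq n := by
        intro z
        rw [← seq_emb_proj hk (emb C' (k + 1) z), ← (emb C' (k + 1) z).compat k, proj_emb]
      rw [h3, h2, ← ih]
      conv_rhs => rw [← f.compat k]
      rfl
  have hl := (proj C' n).cont (Set.range_nonempty _)
    ((arr_mono f (emb C n x)).directed_le.directedOn_range) (isLUB_toHom f (emb C n x))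
  refine hl.unique ⟨?_, fun b hb => ?_⟩
  · rintro _ ⟨_, ⟨k, rfl⟩, rfl⟩
    refine le_trans ?_ (key (max n k) (le_max_left _ _)).le
    exact arr_mono f (emb C n x) (le_max_right n k) n
  · rw [← key n le_rfl]
    exact hb ⟨_, ⟨n, rfl⟩, rfl⟩

theorem toHom_ofHom (g : SHom (Lim C) (Lim C')) : toHom (ofHom g) = g := by
  refine SHom.ext fun x => (isLUB_toHom (ofHom g) x).unique ⟨?_, fun b hb => ?_⟩
  · rintro _ ⟨n, rfl⟩
    exact (emb_proj_le C' n _).trans (g.mono (emb_proj_le C n x))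
  · refine (g.cont (Set.range_nonempty _) (emb_proj_mono x).directed_le.directedOn_range
      (isLUB_emb_proj x)).2 ?_
    rintro _ ⟨_, ⟨k, rfl⟩, rfl⟩
    refine (isLUB_emb_proj _).2 ?_
    rintro _ ⟨m, rfl⟩
    refine le_trans ?_ (hb ⟨max k m, rfl⟩)
    refine (emb_proj_mono _ (le_max_right k m)).trans ?_
    exact (emb C' _).mono (g.mono (emb_proj_mono x (le_max_left k m)) _)

/-- Bilimits commute with function spaces. -/
def arrIso (C C' : Chain) : SHom (Lim C) (Lim C') ≃o Lim (C.arr C') where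
  toFun := ofHom
  invFun := toHom
  left_inv := toHom_ofHom
  right_inv := ofHom_toHom
  map_rel_iff' {g h} := by
    refine ⟨fun hle x => ?_, fun hle n x => hle _ n⟩
    have e1 : toHom (ofHom g) x ≤ toHom (ofHom h) x := by
      refine (isLUB_toHom (ofHom g) x).2 ?_
      rintro _ ⟨n, rfl⟩
      exact ((emb C' n).mono (hle n _)).trans ((isLUB_toHom (ofHom h) x).1 ⟨n, rfl⟩)
    rwa [toHom_ofHom, toHom_ofHom] at e1

end Lim

abbrev Cpo.lim (C : Chain) : Cpo := ⟨Lim C⟩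

/-! ## Pure types and their interpretation -/

/-- Type expressions with `n` free type variables (de Bruijn); `mu` binds a type variable. -/
inductive Ty : ℕ → Type
  | unit {n : ℕ} : Ty n
  | prod {n : ℕ} (P Q : Ty n) : Ty n
  | arr {n : ℕ} (Q P : Ty n) : Ty n
  | sum {n : ℕ} (P Q : Ty n) : Ty n
  | var {n : ℕ} (i : Fin n) : Ty n
  | mu {n : ℕ} (P : Ty (n + 1)) : Ty n

namespace Ty

def rename : {n m : ℕ} → (Fin n → Fin m) → Ty n → Ty m
  | _, _, _, unit => unit
  | _, _, r, prod P Q => prod (rename r P) (rename r Q)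
  | _, _, r, arr Q P => arr (rename r Q) (rename r P)
  | _, _, r, sum P Q => sum (rename r P) (rename r Q)
  | _, _, r, var i => var (r i)
  | _, _, r, mu P => mu (rename (Fin.cases 0 fun i => (r i).succ) P)

def subst : {n m : ℕ} → (Fin n → Ty m) → Ty n → Ty m
  | _, _, _, unit => unit
  | _, _, σ, prod P Q => prod (subst σ P) (subst σ Q)
  | _, _, σ, arr Q P => arr (subst σ Q) (subst σ P)
  | _, _, σ, sum P Q => sum (subst σ P) (subst σ Q)
  | _, _, σ, var i => σ i
  | _, _, σ, mu P => mu (subst (Fin.cases (var 0) fun i => rename Fin.succ (σ i)) P)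

/-- `P[mu P]`. -/
def unfold (P : Ty 1) : Ty 0 := subst (fun _ => mu P) P

end Ty

/-- Pure types are the closed type expressions. -/
abbrev PTy : Type := Ty 0

/-- The finite approximations of the domains of all pure types. They are obtained by iterating,
from the one-point cpo at each type, the functor which is given on families of domains indexed by
pure types by the domain equations
`D unit = two`, `D (P × Q) = D P × D Q`, `D (Q → P) = (D Q → D P)`, `D (P + Q) = (D P ⨿ D Q)_⊥`,
`D (mu P) = D (P[mu P])`. -/
def approx : ℕ → PTy → Cpo
  | 0, _ => Cpo.one
  | _ + 1, .unit => Cpo.two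
  | n + 1, .prod P Q => (approx n P).prod (approx n Q)
  | n + 1, .arr Q P => (approx n Q).arr (approx n P)
  | n + 1, .sum P Q => (approx n P).sum (approx n Q)
  | n + 1, .mu P => approx n P.unfold

/-- The action of that functor on the unique pair out of the initial family. -/
def approxEP : ∀ (n : ℕ) (P : PTy), EP (approx n P) (approx (n + 1) P)
  | 0, _ => EP.init _
  | _ + 1, .unit => EP.refl _
  | n + 1, .prod P Q => (approxEP n P).prod (approxEP n Q)
  | n + 1, .arr Q P => (approxEP n Q).arr (approxEP n P)
  | n + 1, .sum P Q => (approxEP n P).sum (approxEP n Q)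
  | n + 1, .mu P => approxEP n P.unfold

abbrev tyChain (P : PTy) : Chain := ⟨fun n => approx n P, fun n => approxEP n P⟩

/-- The domain interpreting a pure type: the canonical (bilimit) simultaneous solution
of the above domain equations, whose isomorphisms are given below. -/
abbrev dom (P : PTy) : Cpo := Cpo.lim (tyChain P)

def unitIso : Bool ≃o dom .unit :=
  (Lim.constIso Cpo.two).trans (Lim.shiftIso (tyChain .unit)).symm

def prodIso (P Q : PTy) : (dom P × dom Q) ≃o dom (.prod P Q) :=
  (Lim.prodIso (tyChain P) (tyChain Q)).trans (Lim.shiftIso (tyChain (.prod P Q))).symm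

def arrIso (Q P : PTy) : SHom (dom Q) (dom P) ≃o dom (.arr Q P) :=
  (Lim.arrIso (tyChain Q) (tyChain P)).trans (Lim.shiftIso (tyChain (.arr Q P))).symm

def sumIso (P Q : PTy) : LSum (dom P) (dom Q) ≃o dom (.sum P Q) :=
  (Lim.sumIso (tyChain P) (tyChain Q)).trans (Lim.shiftIso (tyChain (.sum P Q))).symm

/-- `fold` from left to right, `unfold` from right to left. -/
def muIso (P : Ty 1) : dom P.unfold ≃o dom (.mu P) :=
  (Lim.shiftIso (tyChain (.mu P))).symm

/-! ## Terms and pure typing -/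

/-- Raw terms, with de Bruijn indices for variables; `lam` and `fix` bind one variable, `case`
binds one variable in each of its two branches. -/
inductive Tm : Type
  | star : Tm
  | pair (M N : Tm) : Tm
  | fst (M : Tm) : Tm
  | snd (M : Tm) : Tm
  | var (i : ℕ) : Tm
  | lam (M : Tm) : Tm
  | app (M N : Tm) : Tm
  | fix (M : Tm) : Tm
  | fold (M : Tm) : Tm
  | unfold (M : Tm) : Tm
  | inl (M : Tm) : Tm
  | inr (M : Tm) : Tm
  | case (M N₁ N₂ : Tm) : Tm

/-- Occurrences of `a` in a list. -/
inductive Var {α : Type} : List α → α → Type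
  | zero {l : List α} {a : α} : Var (a :: l) a
  | succ {l : List α} {a b : α} (v : Var l a) : Var (b :: l) a

/-- The position of an occurrence. -/
def Var.idx {α : Type} : {l : List α} → {a : α} → Var l a → ℕ
  | _, _, .zero => 0
  | _, _, .succ v => v.idx + 1

/-- Families over the occurrences in a list with one more element. -/
def Var.elim {α : Type} {F : α → Type} {l : List α} {a : α} (z : F a)
    (s : ∀ b, Var l b → F b) : ∀ b, Var (a :: l) b → F b
  | _, .zero => z
  | _, .succ v => s _ v

/-- Derivations of `Γ ⊢ M : P` in the pure system. -/
inductive PTyping : List PTy → Tm → PTy → Type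
  | var {Γ : List PTy} {P : PTy} (v : Var Γ P) : PTyping Γ (.var v.idx) P
  | star {Γ : List PTy} : PTyping Γ .star .unit
  | pair {Γ : List PTy} {M N : Tm} {P Q : PTy} :
      PTyping Γ M P → PTyping Γ N Q → PTyping Γ (.pair M N) (.prod P Q)
  | fst {Γ : List PTy} {M : Tm} {P Q : PTy} : PTyping Γ M (.prod P Q) → PTyping Γ (.fst M) P
  | snd {Γ : List PTy} {M : Tm} {P Q : PTy} : PTyping Γ M (.prod P Q) → PTyping Γ (.snd M) Q
  | lam {Γ : List PTy} {M : Tm} {P Q : PTy} :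
      PTyping (Q :: Γ) M P → PTyping Γ (.lam M) (.arr Q P)
  | app {Γ : List PTy} {M N : Tm} {P Q : PTy} :
      PTyping Γ M (.arr Q P) → PTyping Γ N Q → PTyping Γ (.app M N) P
  | fix {Γ : List PTy} {M : Tm} {P : PTy} : PTyping (P :: Γ) M P → PTyping Γ (.fix M) P
  | fold {Γ : List PTy} {M : Tm} {P : Ty 1} :
      PTyping Γ M P.unfold → PTyping Γ (.fold M) (.mu P)
  | unfold {Γ : List PTy} {M : Tm} {P : Ty 1} :
      PTyping Γ M (.mu P) → PTyping Γ (.unfold M) P.unfold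
  | inl {Γ : List PTy} {M : Tm} {P Q : PTy} : PTyping Γ M P → PTyping Γ (.inl M) (.sum P Q)
  | inr {Γ : List PTy} {M : Tm} {P Q : PTy} : PTyping Γ M Q → PTyping Γ (.inr M) (.sum P Q)
  | case {Γ : List PTy} {M N₁ N₂ : Tm} {P₁ P₂ Q : PTy} :
      PTyping Γ M (.sum P₁ P₂) → PTyping (P₁ :: Γ) N₁ Q → PTyping (P₂ :: Γ) N₂ Q →
      PTyping Γ (.case M N₁ N₂) Q

/-- The domain interpreting a pure typing context. -/
def ctxDom : List PTy → Cpo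
  | [] => Cpo.one
  | P :: Γ => (dom P).prod (ctxDom Γ)

def Var.sem : {Γ : List PTy} → {P : PTy} → Var Γ P → SHom (ctxDom Γ) (dom P)
  | _, _, .zero => SHom.fst
  | _, _, .succ v => SHom.comp v.sem SHom.snd

/-- The Scott-continuous function interpreting a typed term. -/
def PTyping.sem : {Γ : List PTy} → {M : Tm} → {P : PTy} → PTyping Γ M P →
    SHom (ctxDom Γ) (dom P)
  | _, _, _, .var v => v.sem
  | _, _, _, .star => SHom.const _ (unitIso true)
  | _, _, _, .pair (P := P) (Q := Q) d d' =>
      SHom.comp (SHom.ofIso (prodIso P Q)) (SHom.pair d.sem d'.sem)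
  | _, _, _, .fst (P := P) (Q := Q) d =>
      SHom.comp SHom.fst (SHom.comp (SHom.ofIso (prodIso P Q).symm) d.sem)
  | _, _, _, .snd (P := P) (Q := Q) d =>
      SHom.comp SHom.snd (SHom.comp (SHom.ofIso (prodIso P Q).symm) d.sem)
  | _, _, _, .lam (P := P) (Q := Q) d =>
      SHom.comp (SHom.ofIso (arrIso Q P)) (SHom.curry d.sem)
  | _, _, _, .app (P := P) (Q := Q) d d' =>
      SHom.comp SHom.eval
        (SHom.pair (SHom.comp (SHom.ofIso (arrIso Q P).symm) d.sem) d'.sem)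
  | _, _, _, .fix d => SHom.comp (SHom.lfp _) (SHom.curry d.sem)
  | _, _, _, .fold (P := P) d => SHom.comp (SHom.ofIso (muIso P)) d.sem
  | _, _, _, .unfold (P := P) d => SHom.comp (SHom.ofIso (muIso P).symm) d.sem
  | _, _, _, .inl (P := P) (Q := Q) d =>
      SHom.comp (SHom.ofIso (sumIso P Q)) (SHom.comp SHom.inl d.sem)
  | _, _, _, .inr (P := P) (Q := Q) d =>
      SHom.comp (SHom.ofIso (sumIso P Q)) (SHom.comp SHom.inr d.sem)
  | _, _, _, .case (P₁ := P₁) (P₂ := P₂) d d₁ d₂ =>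
      SHom.case (SHom.comp (SHom.ofIso (sumIso P₁ P₂).symm) d.sem) d₁.sem d₂.sem

/-! ## Formulae -/

/-- Iteration terms with `k` free iteration variables. -/
inductive ItTm (k : ℕ) : Type
  | var (i : Fin k) : ItTm k
  | zero : ItTm k
  | succ (t : ItTm k) : ItTm k

namespace ItTm

def subst {k k' : ℕ} (σ : Fin k → ItTm k') : ItTm k → ItTm k'
  | var i => σ i
  | zero => zero
  | succ t => succ (subst σ t)

/-- The substitution under a binder. -/
def lift {k k' : ℕ} (σ : Fin k → ItTm k') : Fin (k + 1) → ItTm (k' + 1) :=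
  Fin.cases (var 0) fun i => (σ i).subst fun j => var j.succ

def Free {k : ℕ} (i : Fin k) : ItTm k → Prop
  | var j => i = j
  | zero => False
  | succ t => Free i t

def sem {k : ℕ} (ρ : Fin k → ℕ) : ItTm k → ℕ
  | var i => ρ i
  | zero => 0
  | succ t => sem ρ t + 1

end ItTm

/-- The modalities taking formulae of type `P` to formulae of type `Q`. -/
inductive Modality : PTy → PTy → Type
  | fst {P Q : PTy} : Modality P (.prod P Q)
  | snd {P Q : PTy} : Modality Q (.prod P Q)
  | inl {P Q : PTy} : Modality P (.sum P Q)
  | inr {P Q : PTy} : Modality Q (.sum P Q)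
  | fold {P : Ty 1} : Modality P.unfold (.mu P)

/-- Being one of the two injections. -/
def Modality.IsInj : {P Q : PTy} → Modality P Q → Prop
  | _, _, .inl => True
  | _, _, .inr => True
  | _, _, _ => False

/-- The type-correct formulae of type `P` with `k` free iteration variables over the fixpoint
context `Δ`, regardless of polarities. `mu t φ` and `nu t φ` are the bounded iterations,
which bind a fixpoint variable; `ex` and `all` bind an iteration variable. -/
inductive Fm : ℕ → List PTy → PTy → Type
  | tru {k : ℕ} {Δ : List PTy} {P : PTy} : Fm k Δ P
  | fls {k : ℕ} {Δ : List PTy} {P : PTy} : Fm k Δ P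
  | and {k : ℕ} {Δ : List PTy} {P : PTy} (φ ψ : Fm k Δ P) : Fm k Δ P
  | or {k : ℕ} {Δ : List PTy} {P : PTy} (φ ψ : Fm k Δ P) : Fm k Δ P
  | star {k : ℕ} {Δ : List PTy} : Fm k Δ .unit
  | mod {k : ℕ} {Δ : List PTy} {P Q : PTy} (m : Modality P Q) (φ : Fm k Δ P) : Fm k Δ Q
  | fp {k : ℕ} {Δ : List PTy} {P : PTy} (v : Var Δ P) : Fm k Δ P
  | mu {k : ℕ} {Δ : List PTy} {P : PTy} (t : ItTm k) (φ : Fm k (P :: Δ) P) : Fm k Δ P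
  | nu {k : ℕ} {Δ : List PTy} {P : PTy} (t : ItTm k) (φ : Fm k (P :: Δ) P) : Fm k Δ P
  | ex {k : ℕ} {Δ : List PTy} {P : PTy} (φ : Fm (k + 1) Δ P) : Fm k Δ P
  | all {k : ℕ} {Δ : List PTy} {P : PTy} (φ : Fm (k + 1) Δ P) : Fm k Δ P
  | imp {k : ℕ} {Δ : List PTy} {Q P : PTy} (ψ : Fm k [] Q) (φ : Fm k [] P) : Fm k Δ (.arr Q P)

namespace Fm

/-- Substitution of iteration terms for iteration variables. -/
def substIt : {k k' : ℕ} → {Δ : List PTy} → {P : PTy} → (Fin k → ItTm k') → Fm k Δ P → Fm k' Δ P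
  | _, _, _, _, _, tru => tru
  | _, _, _, _, _, fls => fls
  | _, _, _, _, σ, and φ ψ => and (substIt σ φ) (substIt σ ψ)
  | _, _, _, _, σ, or φ ψ => or (substIt σ φ) (substIt σ ψ)
  | _, _, _, _, _, star => star
  | _, _, _, _, σ, mod m φ => mod m (substIt σ φ)
  | _, _, _, _, _, fp v => fp v
  | _, _, _, _, σ, mu t φ => mu (t.subst σ) (substIt σ φ)
  | _, _, _, _, σ, nu t φ => nu (t.subst σ) (substIt σ φ)
  | _, _, _, _, σ, ex φ => ex (substIt (ItTm.lift σ) φ)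
  | _, _, _, _, σ, all φ => all (substIt (ItTm.lift σ) φ)
  | _, _, _, _, σ, imp ψ φ => imp (substIt σ ψ) (substIt σ φ)

/-- Weakening by one iteration variable, which then does not occur freely. -/
def wkIt {k : ℕ} {Δ : List PTy} {P : PTy} (φ : Fm k Δ P) : Fm (k + 1) Δ P :=
  substIt (fun i => .var i.succ) φ

/-- `φ[t]`, where `t` replaces the iteration variable with index `0`. -/
def instIt {k : ℕ} {Δ : List PTy} {P : PTy} (φ : Fm (k + 1) Δ P) (t : ItTm k) : Fm k Δ P :=
  substIt (Fin.cases t fun i => .var i) φ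

/-- Identification of the iteration variables with indices `0` and `1`. -/
def mergeIt {k : ℕ} {Δ : List PTy} {P : PTy} (φ : Fm (k + 2) Δ P) : Fm (k + 1) Δ P :=
  φ.instIt (.var 0)

/-- Renaming of fixpoint variables. -/
def renFp : {k : ℕ} → {Δ Δ' : List PTy} → {P : PTy} → (∀ Q, Var Δ Q → Var Δ' Q) →
    Fm k Δ P → Fm k Δ' P
  | _, _, _, _, _, tru => tru
  | _, _, _, _, _, fls => fls
  | _, _, _, _, r, and φ ψ => and (renFp r φ) (renFp r ψ)
  | _, _, _, _, r, or φ ψ => or (renFp r φ) (renFp r ψ)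
  | _, _, _, _, _, star => star
  | _, _, _, _, r, mod m φ => mod m (renFp r φ)
  | _, _, _, _, r, fp v => fp (r _ v)
  | _, _, _, _, r, mu t φ => mu t (renFp (Var.elim .zero fun _ v => .succ (r _ v)) φ)
  | _, _, _, _, r, nu t φ => nu t (renFp (Var.elim .zero fun _ v => .succ (r _ v)) φ)
  | _, _, _, _, r, ex φ => ex (renFp r φ)
  | _, _, _, _, r, all φ => all (renFp r φ)
  | _, _, _, _, _, imp ψ φ => imp ψ φ

/-- Substitution of formulae for fixpoint variables. -/
def substFp : {k : ℕ} → {Δ Δ' : List PTy} → {P : PTy} → (∀ Q, Var Δ Q → Fm k Δ' Q) →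
    Fm k Δ P → Fm k Δ' P
  | _, _, _, _, _, tru => tru
  | _, _, _, _, _, fls => fls
  | _, _, _, _, σ, and φ ψ => and (substFp σ φ) (substFp σ ψ)
  | _, _, _, _, σ, or φ ψ => or (substFp σ φ) (substFp σ ψ)
  | _, _, _, _, _, star => star
  | _, _, _, _, σ, mod m φ => mod m (substFp σ φ)
  | _, _, _, _, σ, fp v => σ _ v
  | _, _, _, _, σ, mu t φ => mu t (substFp (Var.elim (fp .zero) fun _ v => renFp (fun _ => .succ) (σ _ v)) φ)
  | _, _, _, _, σ, nu t φ => nu t (substFp (Var.elim (fp .zero) fun _ v => renFp (fun _ => .succ) (σ _ v)) φ)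
  | _, _, _, _, σ, ex φ => ex (substFp (fun _ v => wkIt (σ _ v)) φ)
  | _, _, _, _, σ, all φ => all (substFp (fun _ v => wkIt (σ _ v)) φ)
  | _, _, _, _, _, imp ψ φ => imp ψ φ

/-- `φ[ψ]`, where `ψ` replaces the last fixpoint variable. -/
def instFp {k : ℕ} {Δ : List PTy} {P Q : PTy} (φ : Fm k (Q :: Δ) P) (ψ : Fm k Δ Q) : Fm k Δ P :=
  substFp (Var.elim ψ fun _ v => fp v) φ

/-- The iteration variable `i` occurs freely. -/
def Free : {k : ℕ} → {Δ : List PTy} → {P : PTy} → Fin k → Fm k Δ P → Prop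
  | _, _, _, _, tru => False
  | _, _, _, _, fls => False
  | _, _, _, i, and φ ψ => Free i φ ∨ Free i ψ
  | _, _, _, i, or φ ψ => Free i φ ∨ Free i ψ
  | _, _, _, _, star => False
  | _, _, _, i, mod _ φ => Free i φ
  | _, _, _, _, fp _ => False
  | _, _, _, i, mu t φ => t.Free i ∨ Free i φ
  | _, _, _, i, nu t φ => t.Free i ∨ Free i φ
  | _, _, _, i, ex φ => Free i.succ φ
  | _, _, _, i, all φ => Free i.succ φ
  | _, _, _, i, imp ψ φ => Free i ψ ∨ Free i φ

/-- The conjunctive fragment: `⊤`, `⊥`, conjunctions, modalities and realizability implications. -/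
def IsConj : {k : ℕ} → {Δ : List PTy} → {P : PTy} → Fm k Δ P → Prop
  | _, _, _, tru => True
  | _, _, _, fls => True
  | _, _, _, and φ ψ => IsConj φ ∧ IsConj ψ
  | _, _, _, star => True
  | _, _, _, mod _ φ => IsConj φ
  | _, _, _, imp ψ φ => IsConj ψ ∧ IsConj φ
  | _, _, _, _ => False

/-- Finite conjunctions. -/
def bigAnd {k : ℕ} {Δ : List PTy} {P : PTy} : List (Fm k Δ P) → Fm k Δ P
  | [] => tru
  | φ :: l => and φ (bigAnd l)

end Fm

mutual

/-- The iteration variable `i` is positive in a formula. -/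
inductive Pos : {k : ℕ} → {Δ : List PTy} → {P : PTy} → Fin k → Fm k Δ P → Prop
  | notFree {k : ℕ} {Δ : List PTy} {P : PTy} {i : Fin k} {φ : Fm k Δ P} : ¬ φ.Free i → Pos i φ
  | and {k : ℕ} {Δ : List PTy} {P : PTy} {i : Fin k} {φ ψ : Fm k Δ P} :
      Pos i φ → Pos i ψ → Pos i (φ.and ψ)
  | or {k : ℕ} {Δ : List PTy} {P : PTy} {i : Fin k} {φ ψ : Fm k Δ P} :
      Pos i φ → Pos i ψ → Pos i (φ.or ψ)
  | mod {k : ℕ} {Δ : List PTy} {P Q : PTy} {i : Fin k} {m : Modality P Q} {φ : Fm k Δ P} :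
      Pos i φ → Pos i (φ.mod m)
  | imp {k : ℕ} {Δ : List PTy} {P Q : PTy} {i : Fin k} {ψ : Fm k [] Q} {φ : Fm k [] P} :
      Neg i ψ → Pos i φ → Pos i (Fm.imp (Δ := Δ) ψ φ)
  | ex {k : ℕ} {Δ : List PTy} {P : PTy} {i : Fin k} {φ : Fm (k + 1) Δ P} :
      Pos i.succ φ → Pos i φ.ex
  | mu {k : ℕ} {Δ : List PTy} {P : PTy} {i : Fin k} {t : ItTm k} {φ : Fm k (P :: Δ) P} :
      Pos i φ → Pos i (φ.mu t)
  | nu {k : ℕ} {Δ : List PTy} {P : PTy} {i : Fin k} {t : ItTm k} {φ : Fm k (P :: Δ) P} :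
      Pos i φ → ¬ t.Free i → Pos i (φ.nu t)

/-- The iteration variable `i` is negative in a formula. -/
inductive Neg : {k : ℕ} → {Δ : List PTy} → {P : PTy} → Fin k → Fm k Δ P → Prop
  | notFree {k : ℕ} {Δ : List PTy} {P : PTy} {i : Fin k} {φ : Fm k Δ P} : ¬ φ.Free i → Neg i φ
  | and {k : ℕ} {Δ : List PTy} {P : PTy} {i : Fin k} {φ ψ : Fm k Δ P} :
      Neg i φ → Neg i ψ → Neg i (φ.and ψ)
  | or {k : ℕ} {Δ : List PTy} {P : PTy} {i : Fin k} {φ ψ : Fm k Δ P} :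
      Neg i φ → Neg i ψ → Neg i (φ.or ψ)
  | mod {k : ℕ} {Δ : List PTy} {P Q : PTy} {i : Fin k} {m : Modality P Q} {φ : Fm k Δ P} :
      Neg i φ → Neg i (φ.mod m)
  | imp {k : ℕ} {Δ : List PTy} {P Q : PTy} {i : Fin k} {ψ : Fm k [] Q} {φ : Fm k [] P} :
      Pos i ψ → Neg i φ → Neg i (Fm.imp (Δ := Δ) ψ φ)
  | all {k : ℕ} {Δ : List PTy} {P : PTy} {i : Fin k} {φ : Fm (k + 1) Δ P} :
      Neg i.succ φ → Neg i φ.all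
  | nu {k : ℕ} {Δ : List PTy} {P : PTy} {i : Fin k} {t : ItTm k} {φ : Fm k (P :: Δ) P} :
      Neg i φ → Neg i (φ.nu t)
  | mu {k : ℕ} {Δ : List PTy} {P : PTy} {i : Fin k} {t : ItTm k} {φ : Fm k (P :: Δ) P} :
      Neg i φ → ¬ t.Free i → Neg i (φ.mu t)

end

/-- Polarities: neutral, positive, negative. -/
inductive Sign : Type
  | neutral | pos | neg

/-- The opposite polarity. -/
def Sign.opp : Sign → Sign
  | neutral => neutral
  | pos => neg
  | neg => pos

/-- `InL s φ`: the formula `φ` belongs to the language of polarity `s`. -/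
inductive InL : {k : ℕ} → {Δ : List PTy} → {P : PTy} → Sign → Fm k Δ P → Prop
  | tru {k : ℕ} {Δ : List PTy} {P : PTy} {s : Sign} : InL s (Fm.tru : Fm k Δ P)
  | fls {k : ℕ} {Δ : List PTy} {P : PTy} {s : Sign} : InL s (Fm.fls : Fm k Δ P)
  | and {k : ℕ} {Δ : List PTy} {P : PTy} {s : Sign} {φ ψ : Fm k Δ P} :
      InL s φ → InL s ψ → InL s (φ.and ψ)
  | or {k : ℕ} {Δ : List PTy} {P : PTy} {s : Sign} {φ ψ : Fm k Δ P} :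
      InL s φ → InL s ψ → InL s (φ.or ψ)
  | star {k : ℕ} {Δ : List PTy} {s : Sign} : InL s (Fm.star : Fm k Δ .unit)
  | mod {k : ℕ} {Δ : List PTy} {P Q : PTy} {s : Sign} {m : Modality P Q} {φ : Fm k Δ P} :
      InL s φ → InL s (φ.mod m)
  | fp {k : ℕ} {Δ : List PTy} {P : PTy} {s : Sign} {v : Var Δ P} : InL s (Fm.fp v : Fm k Δ P)
  | mu {k : ℕ} {Δ : List PTy} {P : PTy} {s : Sign} {t : ItTm k} {φ : Fm k (P :: Δ) P} :
      InL s φ → InL s (φ.mu t)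
  | nu {k : ℕ} {Δ : List PTy} {P : PTy} {s : Sign} {t : ItTm k} {φ : Fm k (P :: Δ) P} :
      InL s φ → InL s (φ.nu t)
  | ex {k : ℕ} {Δ : List PTy} {P : PTy} {φ : Fm (k + 1) Δ P} :
      InL .pos φ → Pos 0 φ → InL .pos φ.ex
  | all {k : ℕ} {Δ : List PTy} {P : PTy} {φ : Fm (k + 1) Δ P} :
      InL .neg φ → Neg 0 φ → InL .neg φ.all
  | imp {k : ℕ} {Δ : List PTy} {P Q : PTy} {s : Sign} {ψ : Fm k [] Q} {φ : Fm k [] P} :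
      InL s.opp ψ → InL s φ → InL s (Fm.imp (Δ := Δ) ψ φ)

/-! ## Deduction -/

mutual

/-- Derivable sequents `ψ ⊢ φ` between formulae of polarity `s`. -/
inductive Ded : {k : ℕ} → {Δ : List PTy} → {P : PTy} → Sign → Fm k Δ P → Fm k Δ P → Prop
  -- propositional rules
  | id {k : ℕ} {Δ : List PTy} {P : PTy} {s : Sign} {φ : Fm k Δ P} : InL s φ → Ded s φ φ
  | cut {k : ℕ} {Δ : List PTy} {P : PTy} {s : Sign} {ψ θ φ : Fm k Δ P} :
      Ded s ψ θ → Ded s θ φ → Ded s ψ φ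
  | distr {k : ℕ} {Δ : List PTy} {P : PTy} {s : Sign} {ψ φ θ : Fm k Δ P} :
      InL s ψ → InL s φ → InL s θ →
      Ded s (ψ.and (φ.or θ)) ((ψ.and φ).or (ψ.and θ))
  | andR {k : ℕ} {Δ : List PTy} {P : PTy} {s : Sign} {ψ φ₁ φ₂ : Fm k Δ P} :
      Ded s ψ φ₁ → Ded s ψ φ₂ → Ded s ψ (φ₁.and φ₂)
  | andL₁ {k : ℕ} {Δ : List PTy} {P : PTy} {s : Sign} {ψ₁ ψ₂ φ : Fm k Δ P} :
      InL s ψ₂ → Ded s ψ₁ φ → Ded s (ψ₁.and ψ₂) φ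
  | andL₂ {k : ℕ} {Δ : List PTy} {P : PTy} {s : Sign} {ψ₁ ψ₂ φ : Fm k Δ P} :
      InL s ψ₁ → Ded s ψ₂ φ → Ded s (ψ₁.and ψ₂) φ
  | truR {k : ℕ} {Δ : List PTy} {P : PTy} {s : Sign} {ψ : Fm k Δ P} : InL s ψ → Ded s ψ .tru
  | orR₁ {k : ℕ} {Δ : List PTy} {P : PTy} {s : Sign} {ψ φ₁ φ₂ : Fm k Δ P} :
      InL s φ₂ → Ded s ψ φ₁ → Ded s ψ (φ₁.or φ₂)
  | orR₂ {k : ℕ} {Δ : List PTy} {P : PTy} {s : Sign} {ψ φ₁ φ₂ : Fm k Δ P} :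
      InL s φ₁ → Ded s ψ φ₂ → Ded s ψ (φ₁.or φ₂)
  | orL {k : ℕ} {Δ : List PTy} {P : PTy} {s : Sign} {ψ₁ ψ₂ φ : Fm k Δ P} :
      Ded s ψ₁ φ → Ded s ψ₂ φ → Ded s (ψ₁.or ψ₂) φ
  | flsL {k : ℕ} {Δ : List PTy} {P : PTy} {s : Sign} {φ : Fm k Δ P} : InL s φ → Ded s .fls φ
  -- modal rules
  | injDisj {k : ℕ} {Δ : List PTy} {P Q : PTy} {s : Sign} {φ : Fm k Δ P} {ψ : Fm k Δ Q} :
      InL s φ → InL s ψ → Ded s ((φ.mod .inl).and (ψ.mod .inr)) .fls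
  | modMono {k : ℕ} {Δ : List PTy} {P Q : PTy} {s : Sign} {m : Modality P Q} {ψ φ : Fm k Δ P} :
      Ded s ψ φ → Ded s (ψ.mod m) (φ.mod m)
  | modAnd {k : ℕ} {Δ : List PTy} {P Q : PTy} {s : Sign} {m : Modality P Q} {φ₁ φ₂ : Fm k Δ P} :
      InL s φ₁ → InL s φ₂ → Ded s ((φ₁.mod m).and (φ₂.mod m)) ((φ₁.and φ₂).mod m)
  | modTru {k : ℕ} {Δ : List PTy} {P Q : PTy} {s : Sign} {m : Modality P Q} :
      ¬ m.IsInj → Ded s (Fm.tru : Fm k Δ Q) (Fm.tru.mod m)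
  | modAll {k : ℕ} {Δ : List PTy} {P Q : PTy} {s : Sign} {m : Modality P Q}
      {φ : Fm (k + 1) Δ P} :
      InL s φ.all → Ded s (φ.mod m).all (φ.all.mod m)
  | modOr {k : ℕ} {Δ : List PTy} {P Q : PTy} {s : Sign} {m : Modality P Q} {φ₁ φ₂ : Fm k Δ P} :
      InL s φ₁ → InL s φ₂ → Ded s ((φ₁.or φ₂).mod m) ((φ₁.mod m).or (φ₂.mod m))
  | modFls {k : ℕ} {Δ : List PTy} {P Q : PTy} {s : Sign} {m : Modality P Q} :
      Ded s (Fm.mod m (Fm.fls : Fm k Δ P)) .fls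
  | modEx {k : ℕ} {Δ : List PTy} {P Q : PTy} {s : Sign} {m : Modality P Q}
      {φ : Fm (k + 1) Δ P} :
      InL s φ.ex → Ded s (φ.ex.mod m) (φ.mod m).ex
  -- quantifier rules
  | exR {k : ℕ} {Δ : List PTy} {P : PTy} {s : Sign} {ψ : Fm k Δ P} {φ : Fm (k + 1) Δ P}
      (t : ItTm k) : InL s φ.ex → Ded s ψ (φ.instIt t) → Ded s ψ φ.ex
  | exL {k : ℕ} {Δ : List PTy} {P : PTy} {s : Sign} {θ ψ : Fm k Δ P} {φ : Fm (k + 1) Δ P} :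
      InL s θ → InL s φ.ex → InL s ψ → Ded s (θ.wkIt.and φ) ψ.wkIt → Ded s (θ.and φ.ex) ψ
  | exMerge {k : ℕ} {Δ : List PTy} {P : PTy} {s : Sign} {φ : Fm (k + 2) Δ P} :
      InL s φ.ex.ex → InL s φ.mergeIt.ex → Ded s φ.ex.ex φ.mergeIt.ex
  | allL {k : ℕ} {Δ : List PTy} {P : PTy} {s : Sign} {ψ : Fm k Δ P} {φ : Fm (k + 1) Δ P}
      (t : ItTm k) : InL s φ.all → Ded s (φ.instIt t) ψ → Ded s φ.all ψ
  | allR {k : ℕ} {Δ : List PTy} {P : PTy} {s : Sign} {θ ψ : Fm k Δ P} {φ : Fm (k + 1) Δ P} :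
      InL s θ → InL s φ.all → InL s ψ → Ded s ψ.wkIt (φ.or θ.wkIt) → Ded s ψ (φ.all.or θ)
  | allMerge {k : ℕ} {Δ : List PTy} {P : PTy} {s : Sign} {φ : Fm (k + 2) Δ P} :
      InL s φ.all.all → InL s φ.mergeIt.all → Ded s φ.mergeIt.all φ.all.all
  | muEx {k : ℕ} {Δ : List PTy} {P : PTy} {s : Sign} {t : ItTm k} {φ : Fm (k + 1) (P :: Δ) P} :
      InL s φ.ex → Ded s (φ.ex.mu t) (φ.mu (t.subst fun i => .var i.succ)).ex
  | nuEx {k : ℕ} {Δ : List PTy} {P : PTy} {s : Sign} {t : ItTm k} {φ : Fm (k + 1) (P :: Δ) P} :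
      InL s φ.ex → Ded s (φ.ex.nu t) (φ.nu (t.subst fun i => .var i.succ)).ex
  | muAll {k : ℕ} {Δ : List PTy} {P : PTy} {s : Sign} {t : ItTm k} {φ : Fm (k + 1) (P :: Δ) P} :
      InL s φ.all → Ded s (φ.mu (t.subst fun i => .var i.succ)).all (φ.all.mu t)
  | nuAll {k : ℕ} {Δ : List PTy} {P : PTy} {s : Sign} {t : ItTm k} {φ : Fm (k + 1) (P :: Δ) P} :
      InL s φ.all → Ded s (φ.nu (t.subst fun i => .var i.succ)).all (φ.all.nu t)
  -- bounded iteration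
  | muZero {k : ℕ} {Δ : List PTy} {P : PTy} {s : Sign} {φ : Fm k (P :: Δ) P} :
      InL s φ → Ded s (φ.mu .zero) .fls
  | muSuccL {k : ℕ} {Δ : List PTy} {P : PTy} {s : Sign} {t : ItTm k} {φ : Fm k (P :: Δ) P}
      {ψ : Fm k Δ P} : InL s φ → Ded s (φ.mu t) ψ → Ded s (φ.mu t.succ) (φ.instFp ψ)
  | muSuccR {k : ℕ} {Δ : List PTy} {P : PTy} {s : Sign} {t : ItTm k} {φ : Fm k (P :: Δ) P} :
      InL s φ → Ded s (φ.instFp (φ.mu t)) (φ.mu t.succ)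
  | muMono {k : ℕ} {Δ : List PTy} {P : PTy} {s : Sign} {t : ItTm k} {ψ φ : Fm k (P :: Δ) P} :
      Ded s ψ φ → Ded s (ψ.mu t) (φ.mu t)
  | nuZero {k : ℕ} {Δ : List PTy} {P : PTy} {s : Sign} {φ : Fm k (P :: Δ) P} :
      InL s φ → Ded s .tru (φ.nu .zero)
  | nuSuccR {k : ℕ} {Δ : List PTy} {P : PTy} {s : Sign} {t : ItTm k} {φ : Fm k (P :: Δ) P}
      {ψ : Fm k Δ P} : InL s φ → Ded s ψ (φ.nu t) → Ded s (φ.instFp ψ) (φ.nu t.succ)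
  | nuSuccL {k : ℕ} {Δ : List PTy} {P : PTy} {s : Sign} {t : ItTm k} {φ : Fm k (P :: Δ) P} :
      InL s φ → Ded s (φ.nu t.succ) (φ.instFp (φ.nu t))
  | nuMono {k : ℕ} {Δ : List PTy} {P : PTy} {s : Sign} {t : ItTm k} {ψ φ : Fm k (P :: Δ) P} :
      Ded s ψ φ → Ded s (ψ.nu t) (φ.nu t)
  -- realizability implication
  | impMono {k : ℕ} {Δ : List PTy} {P Q : PTy} {s : Sign} {ψ ψ' : Fm k [] Q} {φ φ' : Fm k [] P} :
      Ded s.opp ψ' ψ → Ded s φ φ' → Ded s (Fm.imp (Δ := Δ) ψ φ) (Fm.imp ψ' φ')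
  | wf {k : ℕ} {Δ : List PTy} {P Q : PTy} {s : Sign} {ψ : Fm (k + 1) [] Q} {φ : Fm k [] P} :
      InL s (Fm.imp (Δ := Δ) ψ.all φ) → InL s (Fm.imp (Δ := Δ) ψ φ.wkIt).ex →
      Ded s (Fm.imp (Δ := Δ) ψ.all φ) (Fm.imp ψ φ.wkIt).ex
  | cc {k : ℕ} {Δ : List PTy} {P Q : PTy} {s : Sign} {ψ : Fm k [] Q} {φ : Fm (k + 1) [] P} :
      InL .neutral ψ → InL s (Fm.imp (Δ := Δ) ψ φ.ex) →
      InL s (Fm.imp (Δ := Δ) ψ.wkIt φ).ex →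
      Ded s (Fm.imp (Δ := Δ) ψ φ.ex) (Fm.imp ψ.wkIt φ).ex
  | exImp {k : ℕ} {Δ : List PTy} {P Q : PTy} {s : Sign} {ψ : Fm (k + 1) [] Q} {φ : Fm k [] P} :
      InL s (Fm.imp (Δ := Δ) ψ φ.wkIt).all → InL s (Fm.imp (Δ := Δ) ψ.ex φ) →
      Ded s (Fm.imp (Δ := Δ) ψ φ.wkIt).all (Fm.imp ψ.ex φ)
  | impAll {k : ℕ} {Δ : List PTy} {P Q : PTy} {s : Sign} {ψ : Fm k [] Q} {φ : Fm (k + 1) [] P} :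
      InL s (Fm.imp (Δ := Δ) ψ.wkIt φ).all → InL s (Fm.imp (Δ := Δ) ψ φ.all) →
      Ded s (Fm.imp (Δ := Δ) ψ.wkIt φ).all (Fm.imp ψ φ.all)
  | impAnd {k : ℕ} {Δ : List PTy} {P Q : PTy} {s : Sign} {ψ : Fm k [] Q} {φ₁ φ₂ : Fm k [] P} :
      InL s.opp ψ → InL s φ₁ → InL s φ₂ →
      Ded s ((Fm.imp (Δ := Δ) ψ φ₁).and (Fm.imp ψ φ₂)) (Fm.imp ψ (φ₁.and φ₂))
  | impTru {k : ℕ} {Δ : List PTy} {P Q : PTy} {s : Sign} {ψ : Fm k [] Q} :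
      InL s.opp ψ → Ded s .tru (Fm.imp (Δ := Δ) (P := P) ψ .tru)
  | orImp {k : ℕ} {Δ : List PTy} {P Q : PTy} {s : Sign} {ψ₁ ψ₂ : Fm k [] Q} {φ : Fm k [] P} :
      InL s.opp ψ₁ → InL s.opp ψ₂ → InL s φ →
      Ded s ((Fm.imp (Δ := Δ) ψ₁ φ).and (Fm.imp ψ₂ φ)) (Fm.imp (ψ₁.or ψ₂) φ)
  | flsImp {k : ℕ} {Δ : List PTy} {P Q : PTy} {s : Sign} {φ : Fm k [] P} :
      InL s φ → Ded s .tru (Fm.imp (Δ := Δ) (Q := Q) .fls φ)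
  | impOr {k : ℕ} {Δ : List PTy} {P Q : PTy} {s : Sign} {δ : Fm k [] Q} {φ₁ φ₂ : Fm k [] P} :
      δ.IsConj → InL s φ₁ → InL s φ₂ →
      Ded s (Fm.imp (Δ := Δ) δ (φ₁.or φ₂)) ((Fm.imp δ φ₁).or (Fm.imp δ φ₂))
  | impFls {k : ℕ} {Δ : List PTy} {P Q : PTy} {s : Sign} {δ : Fm k [] Q} :
      Consistent δ → δ.IsConj → Ded s (Fm.imp (Δ := Δ) (P := P) δ .fls) .fls

/-- The consistency predicate. In `imps`, the family is given by a list, its subfamilies are the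
sublists, and `bad` selects those for which the first of the two alternatives holds. -/
inductive Consistent : {k : ℕ} → {P : PTy} → Fm k [] P → Prop
  | star {k : ℕ} : Consistent (Fm.star : Fm k [] .unit)
  | fold {k : ℕ} {P : Ty 1} {φ : Fm k [] P.unfold} : Consistent φ → Consistent (φ.mod .fold)
  | pair {k : ℕ} {P Q : PTy} {φ : Fm k [] P} {ψ : Fm k [] Q} :
      Consistent φ → Consistent ψ → Consistent ((φ.mod .fst).and (ψ.mod .snd))
  | inl {k : ℕ} {P Q : PTy} {φ : Fm k [] P} :
      Consistent φ → Consistent (φ.mod (.inl : Modality P (.sum P Q)))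
  | inr {k : ℕ} {P Q : PTy} {φ : Fm k [] Q} :
      Consistent φ → Consistent (φ.mod (.inr : Modality Q (.sum P Q)))
  | tru {k : ℕ} {P : PTy} : Consistent (Fm.tru : Fm k [] P)
  | ded {k : ℕ} {P : PTy} {ψ φ : Fm k [] P} :
      Consistent ψ → Ded .neutral ψ φ → φ.IsConj → Consistent φ
  | imps {k : ℕ} {P Q : PTy} (I : List (Fm k [] Q × Fm k [] P))
      (bad : List (Fm k [] Q × Fm k [] P) → Prop) :
      (∀ p ∈ I, Consistent p.1) → (∀ p ∈ I, Consistent p.2) →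
      (∀ J, J.Sublist I → bad J → Ded .neutral (Fm.bigAnd (J.map Prod.fst)) .fls) →
      (∀ J, J.Sublist I → ¬ bad J → Consistent (Fm.bigAnd (J.map Prod.snd))) →
      Consistent (Fm.bigAnd (I.map fun p => Fm.imp p.1 p.2))

end

/-! ## Semantics of formulae -/

/-- Valuations of the fixpoint variables. -/
abbrev FpVal (Δ : List PTy) : Type := ∀ P, Var Δ P → Set (dom P)

def FpVal.cons {Δ : List PTy} {P : PTy} (S : Set (dom P)) (ρ : FpVal Δ) : FpVal (P :: Δ) :=
  Var.elim S ρ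

def FpVal.nil : FpVal [] := fun _ v => nomatch v

def Modality.sem : {P Q : PTy} → Modality P Q → Set (dom P) → Set (dom Q)
  | _, _, .fst (P := P) (Q := Q), S => {x | ((prodIso P Q).symm x).1 ∈ S}
  | _, _, .snd (P := P) (Q := Q), S => {x | ((prodIso P Q).symm x).2 ∈ S}
  | _, _, .inl (P := P) (Q := Q), S => (fun x => sumIso P Q (.inl x)) '' S
  | _, _, .inr (P := P) (Q := Q), S => (fun x => sumIso P Q (.inr x)) '' S
  | _, _, .fold (P := P), S => {x | (muIso P).symm x ∈ S}

/-- The interpretation of a formula under valuations of its iteration and fixpoint variables. -/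
def Fm.sem : {k : ℕ} → {Δ : List PTy} → {P : PTy} → Fm k Δ P → (Fin k → ℕ) → FpVal Δ →
    Set (dom P)
  | _, _, _, .tru, _, _ => Set.univ
  | _, _, _, .fls, _, _ => ∅
  | _, _, _, .and φ ψ, n, ρ => φ.sem n ρ ∩ ψ.sem n ρ
  | _, _, _, .or φ ψ, n, ρ => φ.sem n ρ ∪ ψ.sem n ρ
  | _, _, _, .star, _, _ => {unitIso true}
  | _, _, _, .mod m φ, n, ρ => m.sem (φ.sem n ρ)
  | _, _, _, .fp v, _, ρ => ρ _ v
  | _, _, _, .mu t φ, n, ρ => (fun S => φ.sem n (FpVal.cons S ρ))^[t.sem n] ∅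
  | _, _, _, .nu t φ, n, ρ => (fun S => φ.sem n (FpVal.cons S ρ))^[t.sem n] Set.univ
  | _, _, _, .ex φ, n, ρ => ⋃ i : ℕ, φ.sem (Fin.cases i n) ρ
  | _, _, _, .all φ, n, ρ => ⋂ i : ℕ, φ.sem (Fin.cases i n) ρ
  | _, _, _, .imp (Q := Q) (P := P) ψ φ, n, _ =>
      {f | ∀ x ∈ ψ.sem n FpVal.nil, (arrIso Q P).symm f x ∈ φ.sem n FpVal.nil}

/-! ## Refinement types -/

/-- Refinement types with a given underlying pure type; the formulae in them are closed and
belong to one of the polarised languages. -/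
inductive RTy : PTy → Type
  | pure (P : PTy) : RTy P
  | refine {P : PTy} (φ : Fm 0 [] P) (hφ : ∃ s, InL s φ) : RTy P
  | prod {P Q : PTy} (T : RTy P) (U : RTy Q) : RTy (.prod P Q)
  | arr {Q P : PTy} (U : RTy Q) (T : RTy P) : RTy (.arr Q P)

/-- All formulae in the type belong to the conjunctive fragment. -/
def RTy.IsConj : {P : PTy} → RTy P → Prop
  | _, .pure _ => True
  | _, .refine φ _ => φ.IsConj
  | _, .prod T U => T.IsConj ∧ U.IsConj
  | _, .arr U T => U.IsConj ∧ T.IsConj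

def RTy.sem : {P : PTy} → RTy P → Set (dom P)
  | _, .pure _ => Set.univ
  | _, .refine φ _ => φ.sem Fin.elim0 FpVal.nil
  | _, .prod T U => Modality.sem .fst T.sem ∩ Modality.sem .snd U.sem
  | _, .arr (Q := Q) (P := P) U T => {f | ∀ x ∈ U.sem, (arrIso Q P).symm f x ∈ T.sem}

/-- Subtyping; `T` and `U` are equivalent if both are subtypes of each other. -/
inductive Sub : {P : PTy} → RTy P → RTy P → Prop
  | refl {P : PTy} {T : RTy P} : Sub T T
  | trans {P : PTy} {T U V : RTy P} : Sub T U → Sub U V → Sub T V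
  | toPure {P : PTy} {T : RTy P} : Sub T (.pure P)
  | pureTru {P : PTy} {h : ∃ s, InL s (Fm.tru : Fm 0 [] P)} : Sub (.pure P) (.refine .tru h)
  | ded {P : PTy} {s : Sign} {ψ φ : Fm 0 [] P} {hψ : ∃ s, InL s ψ} {hφ : ∃ s, InL s φ} :
      Ded s ψ φ → Sub (.refine ψ hψ) (.refine φ hφ)
  | prod {P Q : PTy} {T T' : RTy P} {U U' : RTy Q} :
      Sub T T' → Sub U U' → Sub (.prod T U) (.prod T' U')
  | arr {P Q : PTy} {T T' : RTy P} {U U' : RTy Q} :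
      Sub U' U → Sub T T' → Sub (.arr U T) (.arr U' T')
  | prodL {P Q : PTy} {φ : Fm 0 [] P} {ψ : Fm 0 [] Q} {hφ : ∃ s, InL s φ} {hψ : ∃ s, InL s ψ}
      {h : ∃ s, InL s ((φ.mod (.fst : Modality P (.prod P Q))).and (ψ.mod .snd))} :
      Sub (.prod (.refine φ hφ) (.refine ψ hψ)) (.refine ((φ.mod .fst).and (ψ.mod .snd)) h)
  | prodR {P Q : PTy} {φ : Fm 0 [] P} {ψ : Fm 0 [] Q} {hφ : ∃ s, InL s φ} {hψ : ∃ s, InL s ψ}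
      {h : ∃ s, InL s ((φ.mod (.fst : Modality P (.prod P Q))).and (ψ.mod .snd))} :
      Sub (.refine ((φ.mod .fst).and (ψ.mod .snd)) h) (.prod (.refine φ hφ) (.refine ψ hψ))
  | arrL {P Q : PTy} {φ : Fm 0 [] P} {ψ : Fm 0 [] Q} {hφ : ∃ s, InL s φ} {hψ : ∃ s, InL s ψ}
      {h : ∃ s, InL s (Fm.imp (Δ := []) ψ φ)} :
      Sub (.arr (.refine ψ hψ) (.refine φ hφ)) (.refine (.imp ψ φ) h)
  | arrR {P Q : PTy} {φ : Fm 0 [] P} {ψ : Fm 0 [] Q} {hφ : ∃ s, InL s φ} {hψ : ∃ s, InL s ψ}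
      {h : ∃ s, InL s (Fm.imp (Δ := []) ψ φ)} :
      Sub (.refine (.imp ψ φ) h) (.arr (.refine ψ hψ) (.refine φ hφ))

/-- Typing contexts of refinement types. -/
abbrev RCtx : Type := List ((P : PTy) × RTy P)

/-- The underlying pure context. -/
def RCtx.und (Γ : RCtx) : List PTy := List.map Sigma.fst Γ

def RCtx.IsConj (Γ : RCtx) : Prop := ∀ A ∈ Γ, A.2.IsConj

/-- Pointwise subtyping of contexts. -/
inductive CtxSub : RCtx → RCtx → Prop
  | nil : CtxSub [] []
  | cons {P : PTy} {T U : RTy P} {Γ Γ' : RCtx} :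
      Sub T U → CtxSub Γ Γ' → CtxSub (⟨P, T⟩ :: Γ) (⟨P, U⟩ :: Γ')

/-- Derivable typing judgements `Γ ⊢ M : T` of the refinement type system. -/
inductive RTyping : RCtx → Tm → {P : PTy} → RTy P → Prop
  -- basic rules
  | var {Γ : RCtx} {P : PTy} {T : RTy P} (v : Var Γ ⟨P, T⟩) : RTyping Γ (.var v.idx) T
  | lam {Γ : RCtx} {M : Tm} {P Q : PTy} {U : RTy Q} {T : RTy P} :
      RTyping (⟨Q, U⟩ :: Γ) M T → RTyping Γ (.lam M) (.arr U T)
  | app {Γ : RCtx} {M N : Tm} {P Q : PTy} {U : RTy Q} {T : RTy P} :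
      RTyping Γ M (.arr U T) → RTyping Γ N U → RTyping Γ (.app M N) T
  | pair {Γ : RCtx} {M N : Tm} {P Q : PTy} {T : RTy P} {U : RTy Q} :
      RTyping Γ M T → RTyping Γ N U → RTyping Γ (.pair M N) (.prod T U)
  | fst {Γ : RCtx} {M : Tm} {P Q : PTy} {T : RTy P} {U : RTy Q} :
      RTyping Γ M (.prod T U) → RTyping Γ (.fst M) T
  | snd {Γ : RCtx} {M : Tm} {P Q : PTy} {T : RTy P} {U : RTy Q} :
      RTyping Γ M (.prod T U) → RTyping Γ (.snd M) U
  -- pure typing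
  | pure {Γ : RCtx} {M : Tm} {P : PTy} (d : PTyping Γ.und M P) : RTyping Γ M (.pure P)
  -- subtyping
  | sub {Γ Γ' : RCtx} {M : Tm} {P : PTy} {T T' : RTy P} :
      CtxSub Γ' Γ → RTyping Γ M T → Sub T T' → RTyping Γ' M T'
  -- rules for the modalities and for fixpoints
  | star {Γ : RCtx} {h : ∃ s, InL s (Fm.star : Fm 0 [] .unit)} :
      RTyping Γ .star (.refine .star h)
  | pair₁ {Γ : RCtx} {M N : Tm} {P Q : PTy} {φ : Fm 0 [] P} {hφ : ∃ s, InL s φ}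
      {h : ∃ s, InL s (φ.mod (.fst : Modality P (.prod P Q)))} (d : PTyping Γ.und N Q) :
      RTyping Γ M (.refine φ hφ) → RTyping Γ (.pair M N) (.refine (φ.mod .fst) h)
  | pair₂ {Γ : RCtx} {M N : Tm} {P Q : PTy} {φ : Fm 0 [] Q} {hφ : ∃ s, InL s φ}
      {h : ∃ s, InL s (φ.mod (.snd : Modality Q (.prod P Q)))} (d : PTyping Γ.und M P) :
      RTyping Γ N (.refine φ hφ) → RTyping Γ (.pair M N) (.refine (φ.mod .snd) h)
  | proj₁ {Γ : RCtx} {M : Tm} {P Q : PTy} {φ : Fm 0 [] P} {hφ : ∃ s, InL s φ}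
      {h : ∃ s, InL s (φ.mod (.fst : Modality P (.prod P Q)))} :
      RTyping Γ M (.refine (φ.mod .fst) h) → RTyping Γ (.fst M) (.refine φ hφ)
  | proj₂ {Γ : RCtx} {M : Tm} {P Q : PTy} {φ : Fm 0 [] Q} {hφ : ∃ s, InL s φ}
      {h : ∃ s, InL s (φ.mod (.snd : Modality Q (.prod P Q)))} :
      RTyping Γ M (.refine (φ.mod .snd) h) → RTyping Γ (.snd M) (.refine φ hφ)
  | fold {Γ : RCtx} {M : Tm} {P : Ty 1} {φ : Fm 0 [] P.unfold} {hφ : ∃ s, InL s φ}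
      {h : ∃ s, InL s (φ.mod .fold)} :
      RTyping Γ M (.refine φ hφ) → RTyping Γ (.fold M) (.refine (φ.mod .fold) h)
  | unfold {Γ : RCtx} {M : Tm} {P : Ty 1} {φ : Fm 0 [] P.unfold} {hφ : ∃ s, InL s φ}
      {h : ∃ s, InL s (φ.mod .fold)} :
      RTyping Γ M (.refine (φ.mod .fold) h) → RTyping Γ (.unfold M) (.refine φ hφ)
  | inl {Γ : RCtx} {M : Tm} {P Q : PTy} {φ : Fm 0 [] P} {hφ : ∃ s, InL s φ}
      {h : ∃ s, InL s (φ.mod (.inl : Modality P (.sum P Q)))} :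
      RTyping Γ M (.refine φ hφ) → RTyping Γ (.inl M) (.refine (φ.mod .inl) h)
  | inr {Γ : RCtx} {M : Tm} {P Q : PTy} {φ : Fm 0 [] Q} {hφ : ∃ s, InL s φ}
      {h : ∃ s, InL s (φ.mod (.inr : Modality Q (.sum P Q)))} :
      RTyping Γ M (.refine φ hφ) → RTyping Γ (.inr M) (.refine (φ.mod .inr) h)
  | case₁ {Γ : RCtx} {M N₁ N₂ : Tm} {P₁ P₂ Q : PTy} {T : RTy Q} {ψ : Fm 0 [] P₁}
      {hψ : ∃ s, InL s ψ} {h : ∃ s, InL s (ψ.mod (.inl : Modality P₁ (.sum P₁ P₂)))} :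
      RTyping Γ M (.refine (ψ.mod .inl) h) → RTyping (⟨P₁, .refine ψ hψ⟩ :: Γ) N₁ T →
      (d : PTyping (P₂ :: Γ.und) N₂ Q) → RTyping Γ (.case M N₁ N₂) T
  | case₂ {Γ : RCtx} {M N₁ N₂ : Tm} {P₁ P₂ Q : PTy} {T : RTy Q} {ψ : Fm 0 [] P₂}
      {hψ : ∃ s, InL s ψ} {h : ∃ s, InL s (ψ.mod (.inr : Modality P₂ (.sum P₁ P₂)))} :
      RTyping Γ M (.refine (ψ.mod .inr) h) → (d : PTyping (P₁ :: Γ.und) N₁ Q) →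
      RTyping (⟨P₂, .refine ψ hψ⟩ :: Γ) N₂ T → RTyping Γ (.case M N₁ N₂) T
  | fix {Γ : RCtx} {M : Tm} {P : PTy} {ψ φ : Fm 0 [] P} {hψ : ∃ s, InL s ψ}
      {hφ : ∃ s, InL s φ} :
      RTyping Γ (.fix M) (.refine ψ hψ) → RTyping (⟨P, .refine ψ hψ⟩ :: Γ) M (.refine φ hφ) →
      RTyping Γ (.fix M) (.refine φ hφ)
  -- logical rules
  | and {Γ : RCtx} {M : Tm} {P : PTy} {φ ψ : Fm 0 [] P} {hφ : ∃ s, InL s φ}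
      {hψ : ∃ s, InL s ψ} {h : ∃ s, InL s (φ.and ψ)} :
      RTyping Γ M (.refine φ hφ) → RTyping Γ M (.refine ψ hψ) →
      RTyping Γ M (.refine (φ.and ψ) h)
  | fls {Γ₁ Γ₂ : RCtx} {M : Tm} {P Q : PTy} {T : RTy P} {h : ∃ s, InL s (Fm.fls : Fm 0 [] Q)}
      (d : PTyping (RCtx.und (Γ₁ ++ ⟨Q, .refine .fls h⟩ :: Γ₂)) M P) :
      RTyping (Γ₁ ++ ⟨Q, .refine .fls h⟩ :: Γ₂) M T
  | or {Γ₁ Γ₂ : RCtx} {M : Tm} {P Q : PTy} {T : RTy P} {ψ₁ ψ₂ : Fm 0 [] Q}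
      {h₁ : ∃ s, InL s ψ₁} {h₂ : ∃ s, InL s ψ₂} {h : ∃ s, InL s (ψ₁.or ψ₂)} :
      RTyping (Γ₁ ++ ⟨Q, .refine ψ₁ h₁⟩ :: Γ₂) M T →
      RTyping (Γ₁ ++ ⟨Q, .refine ψ₂ h₂⟩ :: Γ₂) M T →
      RTyping (Γ₁ ++ ⟨Q, .refine (ψ₁.or ψ₂) h⟩ :: Γ₂) M T

/-- The tuples of elements of the types in a context. -/
def RCtx.sem : (Γ : RCtx) → Set (ctxDom Γ.und)
  | [] => Set.univ
  | A :: Γ => {u : dom A.1 × ctxDom (RCtx.und Γ) | u.1 ∈ A.2.sem ∧ u.2 ∈ RCtx.sem Γ}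

/-- Sound judgements: the term has a typing of the underlying pure type whose interpretation takes
the tuples in `Γ` to elements of `T`. -/
def Sound (Γ : RCtx) (M : Tm) {P : PTy} (T : RTy P) : Prop :=
  ∃ d : PTyping Γ.und M P, ∀ u ∈ Γ.sem, d.sem u ∈ T.sem

end

end FPC

/-!
The domain `dom P` is the bilimit of the finite posets `approx n P`, and each element of an
approximation has a conjunctive characteristic formula, which holds of exactly the elements above
it. By simultaneous induction on the stage, characteristic formulae are consistent, and the
conjunction of two of them is provably equivalent to `⊥` or to a third; hence every conjunctive
formula is provably equivalent to `⊥` or to a characteristic formula, and entailment between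
conjunctive formulae reduces to the order of the finite approximations.

In a context which assigns a characteristic formula to each variable, a term has every conjunctive
property of its value at the chosen finite elements: Scott continuity yields, for each application,
case distinction and unrolling of a fixpoint, a finite approximation of the argument which suffices.
An arbitrary conjunctive context either contains a type equivalent to `⊥`, or is equivalent to a
context of characteristic formulae, and then the finite elements themselves belong to it, so that
soundness applies to them.
-/

namespace FPC

noncomputable section

/-! ## Finite cpos and compactness -/

section FinitePoset

variable {X Y : Type} [PartialOrder X] [PartialOrder Y]

theorem isLUB_mem_of_finite [Finite X] {d : Set X} {a : X} (hne : d.Nonempty)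
    (hd : DirectedOn (· ≤ ·) d) (ha : IsLUB d a) : a ∈ d := by
  obtain ⟨m, hm⟩ := d.toFinite.exists_maximal hne
  have greatest : m ∈ upperBounds d := fun x hx => by
    obtain ⟨z, hz, hmz, hxz⟩ := hd m hm.prop x hx
    exact hxz.trans (hm.le_of_ge hz hmz)
  exact (ha.2 greatest).antisymm (ha.1 hm.prop) ▸ hm.prop

theorem scottContinuous_of_monotone [Finite X] {f : X → Y} (hf : Monotone f) :
    ScottContinuous f := fun _ hne hd _ ha =>
  ⟨hf.mem_upperBounds_image ha.1,
    fun _ hb => hb (Set.mem_image_of_mem f (isLUB_mem_of_finite hne hd ha))⟩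

theorem exists_apply_eq_of_isLUB_range [Finite Y] {f : X → Y} (hf : ScottContinuous f)
    {u : ℕ → X} (hu : Monotone u) {x : X} (hx : IsLUB (Set.range u) x) : ∃ n, f (u n) = f x := by
  have hlub := hf (Set.range_nonempty u) hu.directed_le.directedOn_range hx
  rw [← Set.range_comp] at hlub
  change f x ∈ Set.range (f ∘ u)
  exact isLUB_mem_of_finite (Set.range_nonempty _)
    (hf.monotone.comp hu).directed_le.directedOn_range hlub

end FinitePoset

section Cpo

variable {X Y : Type} [CompletePartialOrder X] [CompletePartialOrder Y]

instance [Finite X] [Finite Y] : Finite (SHom X Y) :=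
  Finite.of_injective SHom.toFun fun _ _ h => SHom.ext (congrFun h)

instance [Finite X] [Finite Y] : Finite (LSum X Y) :=
  Finite.of_surjective (α := Option (X ⊕ Y))
    (fun | none => .bot | some (.inl x) => .inl x | some (.inr y) => .inr y)
    (fun | .bot => ⟨none, rfl⟩ | .inl x => ⟨some (.inl x), rfl⟩ | .inr y => ⟨some (.inr y), rfl⟩)

theorem EP.e_le_iff (f : EP X Y) {x : X} {y : Y} : f.e x ≤ y ↔ x ≤ f.p y :=
  ⟨fun h => (f.pe x).ge.trans (f.p.mono h), fun h => (f.e.mono h).trans (f.ep y)⟩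

theorem SHom.iter_mono (f : SHom X X) : Monotone fun n => SHom.iter X n f := by
  refine monotone_nat_of_le_succ fun n => ?_
  induction n with
  | zero => exact bot_le
  | succ n ih => exact f.mono ih

theorem SHom.isLUB_lfp (f : SHom X X) :
    IsLUB (Set.range fun n => SHom.iter X n f) (SHom.lfp X f) := by
  have hmono : Monotone (SHom.iter X) := fun _ _ h f => SHom.iter_mono f h
  have hd := hmono.directed_le.directedOn_range
  have hsup := (SHom.directed_apply hd f).isLUB_sSup
  rwa [← SHom.sSup_apply hd f, ← Set.range_comp] at hsup

end Cpo

namespace Lim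

variable {C : Chain} {n k : ℕ}

theorem emb_le_iff {a : C.X n} {y : Lim C} : emb C n a ≤ y ↔ a ≤ y.seq n :=
  ⟨fun h => (proj_emb C n a).ge.trans (h n),
    fun h => ((emb C n).mono h).trans (emb_proj_le C n y)⟩

theorem seq_succ_emb (h : n ≤ k) (a : C.X n) :
    (emb C n a).seq (k + 1) = (C.ep k).e ((emb C n a).seq k) := by
  have emb_seq : emb C k ((emb C n a).seq k) = emb C n a := by
    refine (emb_proj_le C k _).antisymm ?_
    simpa only [proj_emb] using emb_proj_mono (emb C n a) h
  conv_lhs => rw [← emb_seq, ← emb_succ, proj_emb]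

theorem exists_seq_map_emb_eq {D : Chain} [Finite (D.X n)] (f : SHom (Lim C) (Lim D))
    (x : Lim C) : ∃ m, (f (emb C m (x.seq m))).seq n = (f x).seq n :=
  exists_apply_eq_of_isLUB_range (f.cont.comp (proj D n).cont) (emb_proj_mono x)
    (isLUB_emb_proj x)

end Lim

instance finite_approx : ∀ (n : ℕ) (P : PTy), Finite (approx n P)
  | 0, _ => inferInstanceAs (Finite PUnit)
  | _ + 1, .unit => inferInstanceAs (Finite Bool)
  | n + 1, .prod P Q =>
    have := finite_approx n P
    have := finite_approx n Q
    inferInstanceAs (Finite (approx n P × approx n Q))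
  | n + 1, .arr Q P =>
    have := finite_approx n Q
    have := finite_approx n P
    inferInstanceAs (Finite (SHom (approx n Q) (approx n P)))
  | n + 1, .sum P Q =>
    have := finite_approx n P
    have := finite_approx n Q
    inferInstanceAs (Finite (LSum (approx n P) (approx n Q)))
  | n + 1, .mu P => finite_approx n P.unfold

/-! ## Conjunctive formulae and their deductive equivalence -/

section Deduction

variable {k : ℕ} {Δ : List PTy} {P : PTy} {s : Sign}

theorem InL.of_isConj {φ : Fm k Δ P} (h : φ.IsConj) : InL s φ := by
  induction φ generalizing s with
  | tru => exact .tru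
  | fls => exact .fls
  | and φ ψ ihφ ihψ => exact .and (ihφ h.1) (ihψ h.2)
  | star => exact .star
  | mod m φ ih => exact .mod (ih h)
  | imp ψ φ ihψ ihφ => exact .imp (ihψ h.1) (ihφ h.2)
  | _ => exact h.elim

theorem Fm.IsConj.bigAnd {l : List (Fm k Δ P)} (h : ∀ φ ∈ l, φ.IsConj) : (Fm.bigAnd l).IsConj := by
  induction l with
  | nil => trivial
  | cons φ l ih => exact ⟨h φ (by simp), ih fun ψ hψ => h ψ (by simp [hψ])⟩

theorem Ded.andMono {φ φ' ψ ψ' : Fm k Δ P} (hφ : InL s φ) (hψ : InL s ψ) (h : Ded s φ φ')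
    (h' : Ded s ψ ψ') : Ded s (φ.and ψ) (φ'.and ψ') :=
  .andR (.andL₁ hψ h) (.andL₂ hφ h')

theorem Ded.bigAndL {l : List (Fm k Δ P)} (hl : (Fm.bigAnd l).IsConj) {φ : Fm k Δ P} (hφ : φ ∈ l) :
    Ded s (Fm.bigAnd l) φ := by
  induction l with
  | nil => cases hφ
  | cons ψ l ih =>
    rcases List.mem_cons.1 hφ with rfl | hφ
    · exact .andL₁ (.of_isConj hl.2) (.id (.of_isConj hl.1))
    · exact .andL₂ (.of_isConj hl.1) (ih hl.2 hφ)

theorem Ded.bigAndR {ψ : Fm k Δ P} (hψ : InL s ψ) {l : List (Fm k Δ P)}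
    (h : ∀ φ ∈ l, Ded s ψ φ) : Ded s ψ (Fm.bigAnd l) := by
  induction l with
  | nil => exact .truR hψ
  | cons φ l ih => exact .andR (h φ (by simp)) (ih fun χ hχ => h χ (by simp [hχ]))

end Deduction

/-- The set of elements satisfying a closed formula. -/
abbrev Fm.den {P : PTy} (φ : Fm 0 [] P) : Set (dom P) := φ.sem Fin.elim0 FpVal.nil

theorem Fm.mem_bigAnd {P : PTy} {l : List (Fm 0 [] P)} {x : dom P} :
    x ∈ (Fm.bigAnd l).den ↔ ∀ φ ∈ l, x ∈ φ.den := by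
  induction l with
  | nil => simp [Fm.bigAnd, Fm.sem]
  | cons φ l ih => simp [Fm.bigAnd, Fm.sem, ← ih]

section Modality

variable {P Q : PTy}

theorem Modality.sem_inter (m : Modality P Q) (S T : Set (dom P)) :
    m.sem (S ∩ T) = m.sem S ∩ m.sem T := by
  cases m with
  | fst | snd | fold => rfl
  | inl => exact Set.image_inter ((sumIso _ _).injective.comp fun _ _ => LSum.inl.inj)
  | inr => exact Set.image_inter ((sumIso _ _).injective.comp fun _ _ => LSum.inr.inj)

theorem Modality.sem_empty (m : Modality P Q) : m.sem ∅ = ∅ := by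
  cases m with
  | fst | snd | fold => rfl
  | inl | inr => exact Set.image_empty _

theorem Modality.sem_univ {m : Modality P Q} (hm : ¬ m.IsInj) : m.sem Set.univ = Set.univ := by
  cases m with
  | fst | snd | fold => rfl
  | inl | inr => exact (hm trivial).elim

end Modality

/-- Equivalence of closed conjunctive formulae: provable in both directions at neutral polarity.
Recording equality of the denotations as well avoids proving soundness of the deduction rules. -/
structure Equi {P : PTy} (φ ψ : Fm 0 [] P) : Prop where
  left : φ.IsConj
  right : ψ.IsConj
  mp : Ded .neutral φ ψ
  mpr : Ded .neutral ψ φ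
  den_eq : φ.den = ψ.den

namespace Equi

variable {P Q : PTy} {φ φ' ψ ψ' θ : Fm 0 [] P}

theorem refl (hφ : φ.IsConj) : Equi φ φ :=
  ⟨hφ, hφ, .id (.of_isConj hφ), .id (.of_isConj hφ), rfl⟩

theorem symm (h : Equi φ ψ) : Equi ψ φ := ⟨h.right, h.left, h.mpr, h.mp, h.den_eq.symm⟩

theorem trans (h : Equi φ ψ) (h' : Equi ψ θ) : Equi φ θ :=
  ⟨h.left, h'.right, h.mp.cut h'.mp, h'.mpr.cut h.mpr, h.den_eq.trans h'.den_eq⟩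

theorem and (h : Equi φ φ') (h' : Equi ψ ψ') : Equi (φ.and ψ) (φ'.and ψ') where
  left := ⟨h.left, h'.left⟩
  right := ⟨h.right, h'.right⟩
  mp := .andMono (.of_isConj h.left) (.of_isConj h'.left) h.mp h'.mp
  mpr := .andMono (.of_isConj h.right) (.of_isConj h'.right) h.mpr h'.mpr
  den_eq := congrArg₂ (· ∩ ·) h.den_eq h'.den_eq

theorem mod (m : Modality P Q) (h : Equi φ φ') : Equi (φ.mod m) (φ'.mod m) :=
  ⟨h.left, h.right, .modMono h.mp, .modMono h.mpr, congrArg m.sem h.den_eq⟩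

theorem imp {χ χ' : Fm 0 [] Q} (h : Equi φ φ') (h' : Equi χ χ') :
    Equi (Fm.imp (Δ := []) φ χ) (.imp φ' χ') where
  left := ⟨h.left, h'.left⟩
  right := ⟨h.right, h'.right⟩
  mp := .impMono h.mpr h'.mp
  mpr := .impMono h.mp h'.mpr
  den_eq := by
    ext f
    change (∀ x ∈ φ.den, (arrIso P Q).symm f x ∈ χ.den) ↔ ∀ x ∈ φ'.den, _ ∈ χ'.den
    rw [h.den_eq, h'.den_eq]

theorem and_comm (hφ : φ.IsConj) (hψ : ψ.IsConj) : Equi (φ.and ψ) (ψ.and φ) := by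
  have swap {φ ψ : Fm 0 [] P} (hφ : φ.IsConj) (hψ : ψ.IsConj) :
      Ded .neutral (φ.and ψ) (ψ.and φ) :=
    .andR (.andL₂ (.of_isConj hφ) (.id (.of_isConj hψ)))
      (.andL₁ (.of_isConj hψ) (.id (.of_isConj hφ)))
  exact ⟨⟨hφ, hψ⟩, ⟨hψ, hφ⟩, swap hφ hψ, swap hψ hφ, Set.inter_comm _ _⟩

theorem and_and_and_comm (hφ : φ.IsConj) (hψ : ψ.IsConj) (hφ' : φ'.IsConj) (hψ' : ψ'.IsConj) :
    Equi ((φ.and ψ).and (φ'.and ψ')) ((φ.and φ').and (ψ.and ψ')) := by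
  have swap {φ ψ φ' ψ' : Fm 0 [] P} (hφ : φ.IsConj) (hψ : ψ.IsConj) (hφ' : φ'.IsConj)
      (hψ' : ψ'.IsConj) :
      Ded .neutral ((φ.and ψ).and (φ'.and ψ')) ((φ.and φ').and (ψ.and ψ')) :=
    have left : InL .neutral (φ.and ψ) := .and (.of_isConj hφ) (.of_isConj hψ)
    have right : InL .neutral (φ'.and ψ') := .and (.of_isConj hφ') (.of_isConj hψ')
    .andR
      (.andMono left right (.andL₁ (.of_isConj hψ) (.id (.of_isConj hφ)))
        (.andL₁ (.of_isConj hψ') (.id (.of_isConj hφ'))))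
      (.andMono left right (.andL₂ (.of_isConj hφ) (.id (.of_isConj hψ)))
        (.andL₂ (.of_isConj hφ') (.id (.of_isConj hψ'))))
  exact ⟨⟨⟨hφ, hψ⟩, ⟨hφ', hψ'⟩⟩, ⟨⟨hφ, hφ'⟩, ⟨hψ, hψ'⟩⟩, swap hφ hψ hφ' hψ', swap hφ hφ' hψ hψ',
    Set.inter_inter_inter_comm _ _ _ _⟩

theorem and_eq_left (hφ : φ.IsConj) (hψ : ψ.IsConj) (h : Ded .neutral φ ψ)
    (hden : φ.den ⊆ ψ.den) : Equi (φ.and ψ) φ :=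
  ⟨⟨hφ, hψ⟩, hφ, .andL₁ (.of_isConj hψ) (.id (.of_isConj hφ)),
    .andR (.id (.of_isConj hφ)) h, Set.inter_eq_left.2 hden⟩

theorem and_self (hφ : φ.IsConj) : Equi (φ.and φ) φ :=
  .and_eq_left hφ hφ (.id (.of_isConj hφ)) subset_rfl

theorem and_tru (hφ : φ.IsConj) : Equi (φ.and .tru) φ :=
  .and_eq_left hφ trivial (.truR (.of_isConj hφ)) (Set.subset_univ _)

theorem tru_and (hφ : φ.IsConj) : Equi (Fm.tru.and φ) φ :=
  (and_comm (ψ := .tru) hφ trivial).symm.trans (and_tru hφ)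

theorem fls_and (hφ : φ.IsConj) : Equi (Fm.fls.and φ) .fls :=
  .and_eq_left trivial hφ (.flsL (.of_isConj hφ)) (Set.empty_subset _)

theorem and_fls (hφ : φ.IsConj) : Equi (φ.and .fls) .fls :=
  (and_comm (ψ := .fls) hφ trivial).trans (fls_and hφ)

theorem of_mp_fls (hφ : φ.IsConj) (h : Ded .neutral φ .fls) (hden : φ.den = ∅) : Equi φ .fls :=
  ⟨hφ, trivial, h, .flsL (.of_isConj hφ), hden⟩

theorem mod_and {m : Modality P Q} (hφ : φ.IsConj) (hψ : ψ.IsConj) :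
    Equi ((φ.mod m).and (ψ.mod m)) ((φ.and ψ).mod m) where
  left := ⟨hφ, hψ⟩
  right := ⟨hφ, hψ⟩
  mp := .modAnd (.of_isConj hφ) (.of_isConj hψ)
  mpr := .andR (.modMono (.andL₁ (.of_isConj hψ) (.id (.of_isConj hφ))))
    (.modMono (.andL₂ (.of_isConj hφ) (.id (.of_isConj hψ))))
  den_eq := (m.sem_inter _ _).symm

theorem mod_fls (m : Modality P Q) : Equi (Fm.mod m .fls) .fls :=
  .of_mp_fls trivial .modFls m.sem_empty

theorem mod_tru {m : Modality P Q} (hm : ¬ m.IsInj) : Equi (Fm.mod m .tru) .tru :=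
  ⟨trivial, trivial, .truR (.mod .tru), .modTru hm, Modality.sem_univ hm⟩

theorem inl_and_inr {χ : Fm 0 [] Q} (hφ : φ.IsConj) (hχ : χ.IsConj) :
    Equi ((φ.mod .inl).and (χ.mod .inr)) .fls := by
  refine .of_mp_fls ⟨hφ, hχ⟩ (.injDisj (.of_isConj hφ) (.of_isConj hχ)) ?_
  refine Set.eq_empty_of_forall_notMem ?_
  rintro _ ⟨⟨x, -, rfl⟩, ⟨y, -, hy⟩⟩
  exact nomatch (sumIso _ _).injective hy

theorem imp_and {χ : Fm 0 [] Q} (hχ : χ.IsConj) (hφ : φ.IsConj) (hψ : ψ.IsConj) :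
    Equi ((Fm.imp (Δ := []) χ φ).and (.imp χ ψ)) (.imp χ (φ.and ψ)) where
  left := ⟨⟨hχ, hφ⟩, ⟨hχ, hψ⟩⟩
  right := ⟨hχ, hφ, hψ⟩
  mp := .impAnd (.of_isConj hχ) (.of_isConj hφ) (.of_isConj hψ)
  mpr := .andR (.impMono (.id (.of_isConj hχ)) (.andL₁ (.of_isConj hψ) (.id (.of_isConj hφ))))
    (.impMono (.id (.of_isConj hχ)) (.andL₂ (.of_isConj hφ) (.id (.of_isConj hψ))))
  den_eq := Set.ext fun _ => forall₂_and.symm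

theorem fls_imp {χ : Fm 0 [] Q} (hχ : χ.IsConj) :
    Equi (Fm.imp (Δ := []) (.fls : Fm 0 [] P) χ) .tru :=
  ⟨⟨trivial, hχ⟩, trivial, .truR (.of_isConj ⟨trivial, hχ⟩), .flsImp (.of_isConj hχ),
    Set.eq_univ_of_forall fun _ _ hx => hx.elim⟩

theorem imp_fls (hφ : φ.IsConj) (hcons : Consistent φ) (hne : φ.den.Nonempty) :
    Equi (Fm.imp (Δ := []) φ (.fls : Fm 0 [] Q)) .fls :=
  .of_mp_fls ⟨hφ, trivial⟩ (.impFls hcons hφ)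
    (Set.eq_empty_of_forall_notMem fun _ hf => (hf _ hne.choose_spec).elim)

end Equi

/-- An enumeration of a finite type. -/
def elements (X : Type) [Finite X] : List X := (Set.univ : Set X).toFinite.toFinset.toList

theorem mem_elements {X : Type} [Finite X] (x : X) : x ∈ elements X := by
  simp [elements]

/-- The conjunction of the implications `ψ i ⇒ φ i`, over a finite index type. -/
def Fm.imps {ι : Type} [Finite ι] {P Q : PTy} (ψ : ι → Fm 0 [] Q) (φ : ι → Fm 0 [] P) :
    Fm 0 [] (.arr Q P) :=
  Fm.bigAnd ((elements ι).map fun i => .imp (ψ i) (φ i))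

section Imps

variable {ι : Type} [Finite ι] {P Q : PTy} {ψ ψ' : ι → Fm 0 [] Q} {φ φ' : ι → Fm 0 [] P}

theorem Fm.IsConj.imps (hψ : ∀ i, (ψ i).IsConj) (hφ : ∀ i, (φ i).IsConj) :
    (Fm.imps ψ φ).IsConj :=
  .bigAnd (List.forall_mem_map.2 fun i _ => ⟨hψ i, hφ i⟩)

theorem Fm.mem_imps {f : dom (.arr Q P)} :
    f ∈ (Fm.imps ψ φ).den ↔ ∀ i, f ∈ (Fm.imp (Δ := []) (ψ i) (φ i)).den :=
  Fm.mem_bigAnd.trans (List.forall_mem_map.trans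
    ⟨fun h i => h i (mem_elements i), fun h i _ => h i⟩)

theorem Ded.impsL {s : Sign} (h : (Fm.imps ψ φ).IsConj) (i : ι) :
    Ded s (Fm.imps ψ φ) (.imp (ψ i) (φ i)) :=
  .bigAndL h (List.mem_map.2 ⟨i, mem_elements i, rfl⟩)

theorem Ded.impsR {s : Sign} {θ : Fm 0 [] (.arr Q P)} (hθ : InL s θ)
    (h : ∀ i, Ded s θ (.imp (ψ i) (φ i))) : Ded s θ (Fm.imps ψ φ) :=
  .bigAndR hθ (List.forall_mem_map.2 fun i _ => h i)

theorem Equi.imps (hψ : ∀ i, Equi (ψ i) (ψ' i)) (hφ : ∀ i, Equi (φ i) (φ' i)) :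
    Equi (Fm.imps ψ φ) (Fm.imps ψ' φ') where
  left := .imps (fun i => (hψ i).left) fun i => (hφ i).left
  right := .imps (fun i => (hψ i).right) fun i => (hφ i).right
  mp := .impsR (.of_isConj (.imps (fun i => (hψ i).left) fun i => (hφ i).left)) fun i =>
    (Ded.impsL (.imps (fun i => (hψ i).left) fun i => (hφ i).left) i).cut ((hψ i).imp (hφ i)).mp
  mpr := .impsR (.of_isConj (.imps (fun i => (hψ i).right) fun i => (hφ i).right)) fun i =>
    (Ded.impsL (.imps (fun i => (hψ i).right) fun i => (hφ i).right) i).cut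
      ((hψ i).imp (hφ i)).mpr
  den_eq := Set.ext fun _ => Fm.mem_imps.trans <|
    (forall_congr' fun i => ((hψ i).imp (hφ i)).den_eq ▸ Iff.rfl).trans Fm.mem_imps.symm

theorem Equi.imps_and (hψ : ∀ i, (ψ i).IsConj) (hφ : ∀ i, (φ i).IsConj)
    (hφ' : ∀ i, (φ' i).IsConj) :
    Equi ((Fm.imps ψ φ).and (Fm.imps ψ φ')) (Fm.imps ψ fun i => (φ i).and (φ' i)) := by
  have h := Fm.IsConj.imps hψ hφ
  have h' := Fm.IsConj.imps hψ hφ'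
  have hand : (Fm.imps ψ fun i => (φ i).and (φ' i)).IsConj := .imps hψ fun i => ⟨hφ i, hφ' i⟩
  have himp (i : ι) := Equi.imp_and (hψ i) (hφ i) (hφ' i)
  refine ⟨⟨h, h'⟩, hand, ?_, .andR ?_ ?_, ?_⟩
  · exact .impsR (.and (.of_isConj h) (.of_isConj h')) fun i =>
      (Ded.andMono (.of_isConj h) (.of_isConj h') (.impsL h i) (.impsL h' i)).cut (himp i).mp
  · exact .impsR (.of_isConj hand) fun i => (Ded.impsL hand i).cut
      (.impMono (.id (.of_isConj (hψ i))) (.andL₁ (.of_isConj (hφ' i)) (.id (.of_isConj (hφ i)))))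
  · exact .impsR (.of_isConj hand) fun i => (Ded.impsL hand i).cut
      (.impMono (.id (.of_isConj (hψ i))) (.andL₂ (.of_isConj (hφ i)) (.id (.of_isConj (hφ' i)))))
  · ext f
    refine (and_congr Fm.mem_imps Fm.mem_imps).trans (forall_and.symm.trans ?_)
    exact (forall_congr' fun i => (himp i).den_eq ▸ Iff.rfl).trans Fm.mem_imps.symm

end Imps

/-! ## Characteristic formulae of finite elements -/

/-- The characteristic formula of an element `a` of the `n`-th approximation of `dom P`, satisfied
by exactly the elements of `dom P` above the embedding of `a`. -/
def charFm : ∀ (n : ℕ) (P : PTy), approx n P → Fm 0 [] P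
  | 0, _, _ => .tru
  | _ + 1, .unit, a => match (a : Bool) with
    | true => .star
    | false => .tru
  | n + 1, .prod P Q, a => ((charFm n P a.1).mod .fst).and ((charFm n Q a.2).mod .snd)
  | n + 1, .arr Q P, f => Fm.imps (charFm n Q) fun x => charFm n P (f.toFun x)
  | n + 1, .sum P Q, a => match a with
    | .bot => .tru
    | .inl x => (charFm n P x).mod .inl
    | .inr y => (charFm n Q y).mod .inr
  | n + 1, .mu P, a => (charFm n P.unfold a).mod .fold

theorem charFm_isConj (n : ℕ) (P : PTy) (a : approx n P) : (charFm n P a).IsConj := by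
  induction n generalizing P with
  | zero => trivial
  | succ n ih =>
    cases P with
    | var i => exact i.elim0
    | unit => cases a <;> trivial
    | prod P Q => exact ⟨ih P a.1, ih Q a.2⟩
    | arr Q P => exact .imps (ih Q) fun x => ih P _
    | sum P Q =>
      cases a with
      | bot => trivial
      | inl x => exact ih P x
      | inr y => exact ih Q y
    | mu P => exact ih P.unfold a

theorem charFm_inL {s : Sign} {n : ℕ} {P : PTy} (a : approx n P) : InL s (charFm n P a) :=
  .of_isConj (charFm_isConj n P a)

theorem sumIso_mem_inl {P Q : PTy} {S : Set (dom P)} {z : LSum (dom P) (dom Q)} :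
    sumIso P Q z ∈ Modality.inl.sem S ↔ ∃ w ∈ S, .inl w = z := by
  simp only [Modality.sem, Set.mem_image, EmbeddingLike.apply_eq_iff_eq]

theorem sumIso_mem_inr {P Q : PTy} {S : Set (dom Q)} {z : LSum (dom P) (dom Q)} :
    sumIso P Q z ∈ Modality.inr.sem S ↔ ∃ w ∈ S, .inr w = z := by
  simp only [Modality.sem, Set.mem_image, EmbeddingLike.apply_eq_iff_eq]

theorem mem_charFm_arr {n : ℕ} {P Q : PTy}
    (hQ : ∀ {x : approx n Q} {z : dom Q}, z ∈ (charFm n Q x).den ↔ x ≤ z.seq n)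
    (hP : ∀ {x : approx n P} {z : dom P}, z ∈ (charFm n P x).den ↔ x ≤ z.seq n)
    {f : SHom (approx n Q) (approx n P)} {g : SHom (dom Q) (dom P)} :
    arrIso Q P g ∈ (charFm (n + 1) (.arr Q P) f).den ↔
      ∀ x, f x ≤ (g (Lim.emb (tyChain Q) n x)).seq n := by
  refine Fm.mem_imps.trans ⟨fun h x => ?_, fun h x z hz => ?_⟩
  · have hx := h x _ (hQ.2 (Lim.proj_emb (tyChain Q) n x).ge)
    rw [OrderIso.symm_apply_apply] at hx
    exact hP.1 hx
  · rw [OrderIso.symm_apply_apply]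
    exact hP.2 ((h x).trans (g.mono (Lim.emb_le_iff.2 (hQ.1 hz)) n))

theorem mem_charFm {n : ℕ} {P : PTy} {a : approx n P} {y : dom P} :
    y ∈ (charFm n P a).den ↔ a ≤ y.seq n := by
  induction n generalizing P with
  | zero => exact iff_of_true trivial le_rfl
  | succ n ih =>
    cases P with
    | var i => exact i.elim0
    | unit =>
      obtain ⟨b, rfl⟩ := unitIso.surjective y
      cases a with
      | false => exact iff_of_true trivial (Bool.false_le b)
      | true => exact unitIso.injective.eq_iff.trans top_le_iff.symm
    | prod P Q =>
      obtain ⟨z, rfl⟩ := (prodIso P Q).surjective y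
      exact and_congr ih ih
    | arr Q P =>
      obtain ⟨g, rfl⟩ := (arrIso Q P).surjective y
      exact mem_charFm_arr ih ih
    | sum P Q =>
      obtain ⟨z, rfl⟩ := (sumIso P Q).surjective y
      cases a with
      | bot => exact iff_of_true trivial trivial
      | inl x =>
        refine sumIso_mem_inl.trans ?_
        cases z with
        | inl z => exact ⟨fun ⟨_, hw, h⟩ => LSum.inl.inj h ▸ ih.1 hw, fun h => ⟨z, ih.2 h, rfl⟩⟩
        | bot | inr => exact iff_of_false (fun ⟨_, _, h⟩ => nomatch h) id
      | inr x =>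
        refine sumIso_mem_inr.trans ?_
        cases z with
        | inr z => exact ⟨fun ⟨_, hw, h⟩ => LSum.inr.inj h ▸ ih.1 hw, fun h => ⟨z, ih.2 h, rfl⟩⟩
        | bot | inl => exact iff_of_false (fun ⟨_, _, h⟩ => nomatch h) id
    | mu P =>
      obtain ⟨z, rfl⟩ := (muIso P).surjective y
      exact ih

theorem emb_mem_den_charFm {n : ℕ} {P : PTy} (a : approx n P) :
    Lim.emb (tyChain P) n a ∈ (charFm n P a).den :=
  mem_charFm.2 (Lim.proj_emb (tyChain P) n a).ge

theorem den_charFm_subset_iff {n : ℕ} {P : PTy} {a b : approx n P} :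
    (charFm n P b).den ⊆ (charFm n P a).den ↔ a ≤ b :=
  ⟨fun h => (mem_charFm.1 (h (emb_mem_den_charFm b))).trans (Lim.proj_emb (tyChain P) n b).le,
    fun h _ hy => mem_charFm.2 (h.trans (mem_charFm.1 hy))⟩

theorem Ded.charFm_antitone {n : ℕ} {P : PTy} {a b : approx n P} (h : a ≤ b) :
    Ded .neutral (charFm n P b) (charFm n P a) := by
  induction n generalizing P with
  | zero => exact .truR .tru
  | succ n ih =>
    cases P with
    | var i => exact i.elim0
    | unit =>
      cases a with
      | false => exact .truR (charFm_inL b)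
      | true =>
        obtain rfl : b = true := top_le_iff (α := Bool).1 h
        exact .id .star
    | prod P Q =>
      exact .andMono (.mod (charFm_inL _)) (.mod (charFm_inL _)) (.modMono (ih h.1))
        (.modMono (ih h.2))
    | arr Q P =>
      exact .impsR (charFm_inL b) fun x =>
        (Ded.impsL (charFm_isConj (n + 1) (.arr Q P) b) x).cut
          (.impMono (.id (charFm_inL x)) (ih (h x)))
    | sum P Q =>
      cases a with
      | bot => exact .truR (charFm_inL b)
      | inl x =>
        obtain ⟨x', rfl, hx⟩ := LSum.inl_le.1 h
        exact .modMono (ih hx)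
      | inr y =>
        obtain ⟨y', rfl, hy⟩ := LSum.inr_le.1 h
        exact .modMono (ih hy)
    | mu P => exact .modMono (ih h)

theorem Ded.charFm_bot {n : ℕ} {P : PTy} : Ded .neutral .tru (charFm n P ⊥) := by
  induction n generalizing P with
  | zero => exact .id .tru
  | succ n ih =>
    cases P with
    | var i => exact i.elim0
    | unit | sum => exact .id .tru
    | prod P Q =>
      exact .andR (.cut (.modTru _root_.id) (.modMono ih)) (.cut (.modTru _root_.id) (.modMono ih))
    | arr Q P =>
      exact .impsR .tru fun x =>
        .cut (.impTru (charFm_inL x)) (.impMono (.id (charFm_inL x)) ih)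
    | mu P => exact .cut (.modTru _root_.id) (.modMono ih)

theorem Equi.charFm_bot {n : ℕ} {P : PTy} : Equi (charFm n P ⊥) .tru :=
  ⟨charFm_isConj n P ⊥, trivial, .truR (charFm_inL ⊥), .charFm_bot,
    Set.eq_univ_of_forall fun _ => mem_charFm.2 bot_le⟩

theorem den_charFm_e {n : ℕ} {P : PTy} (a : approx n P) :
    (charFm (n + 1) P ((approxEP n P).e a)).den = (charFm n P a).den := by
  ext y
  have compat : (approxEP n P).p (y.seq (n + 1)) = y.seq n := y.compat n
  rw [mem_charFm, mem_charFm, EP.e_le_iff, compat]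

theorem Equi.charFm_e_arr {n : ℕ} {P Q : PTy}
    (hQ : ∀ x, Equi (charFm (n + 1) Q ((approxEP n Q).e x)) (charFm n Q x))
    (hP : ∀ x, Equi (charFm (n + 1) P ((approxEP n P).e x)) (charFm n P x))
    (f : approx (n + 1) (.arr Q P)) :
    Equi (charFm (n + 2) (.arr Q P) ((approxEP (n + 1) (.arr Q P)).e f))
      (charFm (n + 1) (.arr Q P) f) := by
  refine ⟨charFm_isConj _ _ _, charFm_isConj _ _ _, ?_, ?_, den_charFm_e f⟩
  · refine .impsR (charFm_inL _) fun x =>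
      (Ded.impsL (charFm_isConj (n + 2) (.arr Q P) _) ((approxEP n Q).e x)).cut
        (.impMono (hQ x).mpr ?_)
    change Ded _ (charFm (n + 1) P ((approxEP n P).e (f.toFun ((approxEP n Q).p _)))) _
    rw [(approxEP n Q).pe]
    exact (hP _).mp
  · refine .impsR (charFm_inL _) fun y =>
      (Ded.impsL (charFm_isConj (n + 1) (.arr Q P) f) ((approxEP n Q).p y)).cut
        (.impMono ?_ (hP _).mpr)
    exact (Ded.charFm_antitone ((approxEP n Q).ep y)).cut (hQ _).mp

theorem Equi.charFm_e {n : ℕ} {P : PTy} (a : approx n P) :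
    Equi (charFm (n + 1) P ((approxEP n P).e a)) (charFm n P a) := by
  induction n generalizing P with
  | zero => exact .charFm_bot
  | succ n ih =>
    cases P with
    | var i => exact i.elim0
    | unit => cases a <;> exact .refl trivial
    | prod P Q => exact ((ih a.1).mod .fst).and ((ih a.2).mod .snd)
    | arr Q P => exact .charFm_e_arr ih ih a
    | sum P Q =>
      cases a with
      | bot => exact .refl trivial
      | inl x => exact (ih x).mod .inl
      | inr y => exact (ih y).mod .inr
    | mu P => exact (ih a).mod .fold

theorem Equi.charFm_seq_emb {n N : ℕ} (h : n ≤ N) {P : PTy} (a : approx n P) :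
    Equi (charFm n P a) (charFm N P ((Lim.emb (tyChain P) n a).seq N)) := by
  induction N, h using Nat.le_induction with
  | base => exact (Lim.proj_emb (tyChain P) n a).symm ▸ .refl (charFm_isConj n P a)
  | succ N h ih =>
    rw [Lim.seq_succ_emb h]
    exact ih.trans (Equi.charFm_e (P := P) _).symm

theorem Ded.charFm_of_emb_le {m n : ℕ} {P : PTy} {a : approx n P} {b : approx m P}
    (h : Lim.emb (tyChain P) n a ≤ Lim.emb (tyChain P) m b) :
    Ded .neutral (charFm m P b) (charFm n P a) :=
  (Equi.charFm_seq_emb (le_max_right n m) b).mp.cut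
    ((Ded.charFm_antitone (h (max n m))).cut (Equi.charFm_seq_emb (le_max_left n m) a).mpr)

/-! ## Deciding conjunctive formulae -/

/-- The formula `φ` is equivalent to `⊥` or to the characteristic formula of an element of the
`n`-th approximation, so that up to equivalence it is determined by its denotation. -/
def DecidedAt {P : PTy} (n : ℕ) (φ : Fm 0 [] P) : Prop :=
  Equi φ .fls ∨ ∃ a, Equi φ (charFm n P a)

namespace DecidedAt

variable {n N : ℕ} {P Q : PTy} {φ ψ : Fm 0 [] P}

theorem of_equi (h : Equi φ ψ) (hψ : DecidedAt n ψ) : DecidedAt n φ :=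
  hψ.imp h.trans fun ⟨a, ha⟩ => ⟨a, h.trans ha⟩

theorem isConj : DecidedAt n φ → φ.IsConj
  | .inl h => h.left
  | .inr ⟨_, h⟩ => h.left

theorem charFm_self (a : approx n P) : DecidedAt n (charFm n P a) :=
  .inr ⟨a, .refl (charFm_isConj n P a)⟩

theorem fls : DecidedAt n (.fls : Fm 0 [] P) := .inl (.refl trivial)

theorem tru : DecidedAt n (.tru : Fm 0 [] P) := .inr ⟨⊥, Equi.charFm_bot.symm⟩

theorem mono (hnN : n ≤ N) (h : DecidedAt n φ) : DecidedAt N φ :=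
  h.imp_right fun ⟨_, ha⟩ => ⟨_, ha.trans (.charFm_seq_emb hnN _)⟩

theorem pair {ψ : Fm 0 [] Q} (hφ : DecidedAt n φ) (hψ : DecidedAt n ψ) :
    DecidedAt (n + 1) ((φ.mod .fst).and (ψ.mod .snd)) := by
  rcases hφ with h | ⟨a, ha⟩
  · exact .inl ((((h.mod .fst).trans (.mod_fls _)).and (.refl hψ.isConj)).trans
      (.fls_and hψ.isConj))
  rcases hψ with h | ⟨b, hb⟩
  · exact .inl (((ha.mod .fst).and ((h.mod .snd).trans (.mod_fls _))).trans
      (.and_fls (charFm_isConj n P a)))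
  · exact .inr ⟨(a, b), (ha.mod .fst).and (hb.mod .snd)⟩

theorem mod (m : Modality P Q) (h : DecidedAt n φ) : DecidedAt (n + 1) (φ.mod m) := by
  have of_fls (h : Equi φ .fls) : DecidedAt (n + 1) (φ.mod m) :=
    .inl ((h.mod m).trans (.mod_fls m))
  have hφ : (φ.mod m).IsConj := h.isConj
  cases m with
  | fst =>
    exact .of_equi ((Equi.and_tru hφ).symm.trans (.and (.refl hφ) (Equi.mod_tru id).symm))
      (h.pair .tru)
  | snd =>
    exact .of_equi ((Equi.tru_and hφ).symm.trans (.and (Equi.mod_tru id).symm (.refl hφ)))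
      (tru.pair h)
  | inl => exact h.elim of_fls fun ⟨a, ha⟩ => .inr ⟨.inl a, ha.mod .inl⟩
  | inr => exact h.elim of_fls fun ⟨a, ha⟩ => .inr ⟨.inr a, ha.mod .inr⟩
  | fold => exact h.elim of_fls fun ⟨a, ha⟩ => .inr ⟨a, ha.mod .fold⟩

theorem imps {φ : approx n Q → Fm 0 [] P}
    (hcons : ∀ x, Consistent (charFm n Q x)) (hφ : ∀ x, DecidedAt n (φ x))
    (hanti : ∀ x y, x ≤ y → (φ y).den ⊆ (φ x).den) :
    DecidedAt (n + 1) (Fm.imps (charFm n Q) φ) := by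
  by_cases hfls : ∃ x, Equi (φ x) .fls
  · obtain ⟨x, hx⟩ := hfls
    have himp : Equi (.imp (charFm n Q x) (φ x)) .fls :=
      (Equi.imp (.refl (charFm_isConj n Q x)) hx).trans
        (.imp_fls (charFm_isConj n Q x) (hcons x) ⟨_, emb_mem_den_charFm x⟩)
    have hconj : (Fm.imps (charFm n Q) φ).IsConj :=
      .imps (charFm_isConj n Q) fun x => (hφ x).isConj
    exact .inl (.of_mp_fls hconj ((Ded.impsL hconj x).cut himp.mp)
      (Set.subset_eq_empty (fun _ hf => Fm.mem_imps.1 hf x) himp.den_eq))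
  · choose g hg using fun x => (hφ x).resolve_left fun h => hfls ⟨x, h⟩
    have hmono : Monotone g := fun x y hxy => den_charFm_subset_iff.1 <| by
      rw [← (hg x).den_eq, ← (hg y).den_eq]
      exact hanti x y hxy
    exact .inr ⟨(⟨g, scottContinuous_of_monotone hmono⟩ : SHom (approx n Q) (approx n P)),
      .imps (fun x => .refl (charFm_isConj n Q x)) hg⟩

theorem and_of_charFm
    (hand : ∀ a b : approx n P, DecidedAt n ((charFm n P a).and (charFm n P b)))
    (hφ : DecidedAt n φ) (hψ : DecidedAt n ψ) : DecidedAt n (φ.and ψ) := by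
  rcases hφ with h | ⟨a, ha⟩
  · exact .inl ((h.and (.refl hψ.isConj)).trans (.fls_and hψ.isConj))
  rcases hψ with h | ⟨b, hb⟩
  · exact .inl ((ha.and h).trans (.and_fls (charFm_isConj n P a)))
  · exact .of_equi (ha.and hb) (hand a b)

theorem charFm_and_arr (hcons : ∀ x, Consistent (charFm n Q x))
    (hand : ∀ a b : approx n P, DecidedAt n ((charFm n P a).and (charFm n P b)))
    (f g : approx (n + 1) (.arr Q P)) :
    DecidedAt (n + 1) ((charFm (n + 1) (.arr Q P) f).and (charFm (n + 1) (.arr Q P) g)) := by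
  have hP := charFm_isConj n P
  refine .of_equi (.imps_and (charFm_isConj n Q) (fun x => hP _) fun x => hP _)
    (imps hcons (fun x => hand (f.toFun x) (g.toFun x)) fun x y hxy => ?_)
  exact Set.inter_subset_inter (den_charFm_subset_iff.2 (SHom.mono f hxy))
    (den_charFm_subset_iff.2 (SHom.mono g hxy))

theorem charFm_and_sum
    (hP : ∀ a b : approx n P, DecidedAt n ((charFm n P a).and (charFm n P b)))
    (hQ : ∀ a b : approx n Q, DecidedAt n ((charFm n Q a).and (charFm n Q b)))
    (a b : LSum (approx n P) (approx n Q)) :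
    DecidedAt (n + 1) ((charFm (n + 1) (.sum P Q) a).and (charFm (n + 1) (.sum P Q) b)) := by
  have conj (a : LSum (approx n P) (approx n Q)) := charFm_isConj (n + 1) (.sum P Q) a
  cases a with
  | bot => exact .of_equi (.tru_and (conj b)) (.charFm_self _)
  | inl x =>
    cases b with
    | bot => exact .of_equi (.and_tru (conj (.inl x))) (.charFm_self _)
    | inl y =>
      exact .of_equi (.mod_and (charFm_isConj n P x) (charFm_isConj n P y)) ((hP x y).mod _)
    | inr y => exact .inl (.inl_and_inr (charFm_isConj n P x) (charFm_isConj n Q y))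
  | inr x =>
    cases b with
    | bot => exact .of_equi (.and_tru (conj (.inr x))) (.charFm_self _)
    | inl y =>
      exact .inl ((Equi.and_comm (conj (.inr x)) (conj (.inl y))).trans
        (.inl_and_inr (charFm_isConj n P y) (charFm_isConj n Q x)))
    | inr y =>
      exact .of_equi (.mod_and (charFm_isConj n Q x) (charFm_isConj n Q y)) ((hQ x y).mod _)

theorem charFm_and_succ (hcons : ∀ P x, Consistent (charFm n P x))
    (hand : ∀ P (a b : approx n P), DecidedAt n ((charFm n P a).and (charFm n P b)))
    (a b : approx (n + 1) P) :
    DecidedAt (n + 1) ((charFm (n + 1) P a).and (charFm (n + 1) P b)) := by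
  have conj {P} (a : approx n P) := charFm_isConj n P a
  cases P with
  | var i => exact i.elim0
  | unit =>
    cases a with
    | false => exact .of_equi (.tru_and (charFm_isConj _ _ b)) (.charFm_self b)
    | true =>
      cases b with
      | false => exact .of_equi (.and_tru trivial) (.charFm_self (n := n + 1) (P := .unit) true)
      | true => exact .of_equi (.and_self trivial) (.charFm_self (n := n + 1) (P := .unit) true)
  | prod P Q =>
    have conj_mod {P R} (m : Modality P R) (a : approx n P) : ((charFm n P a).mod m).IsConj :=
      conj a
    exact .of_equi ((Equi.and_and_and_comm (conj_mod .fst a.1) (conj_mod .snd a.2)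
        (conj_mod .fst b.1) (conj_mod .snd b.2)).trans
      (.and (.mod_and (conj a.1) (conj b.1)) (.mod_and (conj a.2) (conj b.2))))
      ((hand P a.1 b.1).pair (hand Q a.2 b.2))
  | arr Q P => exact charFm_and_arr (hcons Q) (hand P) a b
  | sum P Q => exact charFm_and_sum (hand P) (hand Q) a b
  | mu P =>
    exact .of_equi (.mod_and (charFm_isConj n P.unfold a) (charFm_isConj n P.unfold b))
      ((hand P.unfold a b).mod .fold)

theorem bigAnd_charFm
    (hand : ∀ a b : approx n P, DecidedAt n ((charFm n P a).and (charFm n P b)))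
    (l : List (approx n P)) : DecidedAt n (Fm.bigAnd (l.map (charFm n P))) := by
  induction l with
  | nil => exact .tru
  | cons a l ih => exact .and_of_charFm hand (.charFm_self a) ih

end DecidedAt

theorem Consistent.charFm_arr {n : ℕ} {P Q : PTy} (hQ : ∀ x, Consistent (charFm n Q x))
    (hP : ∀ x, Consistent (charFm n P x))
    (hand : ∀ a b : approx n Q, DecidedAt n ((charFm n Q a).and (charFm n Q b)))
    (f : approx (n + 1) (.arr Q P)) : Consistent (charFm (n + 1) (.arr Q P) f) := by
  let clause (x : approx n Q) : Fm 0 [] Q × Fm 0 [] P := (charFm n Q x, charFm n P (f.toFun x))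
  have hclauses := Consistent.imps ((elements (approx n Q)).map clause)
    (fun J => Ded .neutral (Fm.bigAnd (J.map Prod.fst)) .fls)
    (List.forall_mem_map.2 fun x _ => hQ x) (List.forall_mem_map.2 fun x _ => hP _)
    (fun _ _ h => h) fun J hJ hbad => ?_
  · rwa [List.map_map] at hclauses
  obtain ⟨L, -, rfl⟩ := List.sublist_map_iff.1 hJ
  rw [List.map_map] at hbad ⊢
  -- Jointly consistent arguments have an upper bound `c`, and then `f c` bounds their values.
  rcases DecidedAt.bigAnd_charFm hand L with h | ⟨c, hc⟩
  · exact absurd h.mp hbad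
  have le_c : ∀ x ∈ L, x ≤ c := fun x hx => den_charFm_subset_iff.1 fun y hy =>
    Fm.mem_bigAnd.1 (hc.den_eq.ge hy) _ (List.mem_map_of_mem hx)
  refine (hP (f.toFun c)).ded (.bigAndR (charFm_inL _) (List.forall_mem_map.2 fun x hx => ?_))
    (.bigAnd (List.forall_mem_map.2 fun x _ => charFm_isConj n P _))
  exact .charFm_antitone (SHom.mono f (le_c x hx))

theorem Consistent.charFm_succ {n : ℕ} {P : PTy} (hcons : ∀ P x, Consistent (charFm n P x))
    (hand : ∀ P (a b : approx n P), DecidedAt n ((charFm n P a).and (charFm n P b)))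
    (a : approx (n + 1) P) : Consistent (charFm (n + 1) P a) := by
  cases P with
  | var i => exact i.elim0
  | unit =>
    cases a with
    | false => exact .tru
    | true => exact .star
  | prod P Q => exact .pair (hcons P a.1) (hcons Q a.2)
  | arr Q P => exact .charFm_arr (hcons Q) (hcons P) (hand Q) a
  | sum P Q =>
    cases a with
    | bot => exact .tru
    | inl x => exact .inl (hcons P x)
    | inr y => exact .inr (hcons Q y)
  | mu P => exact .fold (hcons P.unfold a)

theorem consistent_charFm_and_decidedAt_charFm_and (n : ℕ) :
    (∀ P x, Consistent (charFm n P x)) ∧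
      ∀ P (a b : approx n P), DecidedAt n ((charFm n P a).and (charFm n P b)) := by
  induction n with
  | zero => exact ⟨fun _ _ => .tru, fun _ _ _ => .of_equi (.and_self trivial) .tru⟩
  | succ n ih => exact ⟨fun _ => .charFm_succ ih.1 ih.2, fun _ => .charFm_and_succ ih.1 ih.2⟩

theorem consistent_charFm {n : ℕ} {P : PTy} (a : approx n P) : Consistent (charFm n P a) :=
  (consistent_charFm_and_decidedAt_charFm_and n).1 P a

namespace DecidedAt

variable {n : ℕ} {P Q : PTy}

theorem and {φ ψ : Fm 0 [] P} (hφ : DecidedAt n φ) (hψ : DecidedAt n ψ) : DecidedAt n (φ.and ψ) :=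
  .and_of_charFm ((consistent_charFm_and_decidedAt_charFm_and n).2 P) hφ hψ

open Classical in
theorem charFm_imp (a : approx n Q) {φ : Fm 0 [] P} (hφ : DecidedAt n φ) :
    DecidedAt (n + 1) (.imp (charFm n Q a) φ) := by
  -- The step function at `a`, written as a family of implications over all of `approx n Q`.
  let branch (x : approx n Q) : Fm 0 [] P := if a ≤ x then φ else .tru
  have pos {x} (h : a ≤ x) : branch x = φ := if_pos h
  have neg {x} (h : ¬ a ≤ x) : branch x = .tru := if_neg h
  have hbranch (x) : DecidedAt n (branch x) := by
    by_cases h : a ≤ x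
    · rwa [pos h]
    · exact neg h ▸ .tru
  have hdec := imps (fun x => consistent_charFm x) hbranch fun x y hxy => by
    by_cases h : a ≤ x
    · rw [pos h, pos (h.trans hxy)]
    · exact neg h ▸ Set.subset_univ _
  have hconj : (Fm.imp (charFm n Q a) φ : Fm 0 [] _).IsConj := ⟨charFm_isConj n Q a, hφ.isConj⟩
  have hconj' := Fm.IsConj.imps (charFm_isConj n Q) fun x => (hbranch x).isConj
  refine .of_equi ⟨hconj, hconj', .impsR (.of_isConj hconj) fun x => ?_, ?_, ?_⟩ hdec
  · by_cases h : a ≤ x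
    · rw [pos h]
      exact .impMono (.charFm_antitone h) (.id (.of_isConj hφ.isConj))
    · rw [neg h]
      exact .cut (.truR (.of_isConj hconj)) (.impTru (charFm_inL x))
  · exact pos le_rfl ▸ Ded.impsL hconj' a
  · ext f
    refine ⟨fun hf => Fm.mem_imps.2 fun x z hz => ?_, fun hf => pos le_rfl ▸ Fm.mem_imps.1 hf a⟩
    by_cases h : a ≤ x
    · exact pos h ▸ hf z (den_charFm_subset_iff.2 h hz)
    · exact neg h ▸ trivial

theorem imp {ψ : Fm 0 [] Q} {φ : Fm 0 [] P} (hψ : DecidedAt n ψ) (hφ : DecidedAt n φ) :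
    DecidedAt (n + 1) (.imp ψ φ) := by
  rcases hψ with h | ⟨a, ha⟩
  · exact .of_equi ((h.imp (.refl hφ.isConj)).trans (.fls_imp hφ.isConj)) .tru
  · exact .of_equi (ha.imp (.refl hφ.isConj)) (.charFm_imp a hφ)

end DecidedAt

theorem Fm.IsConj.exists_decidedAt : ∀ {P : PTy} {φ : Fm 0 [] P}, φ.IsConj → ∃ n, DecidedAt n φ
  | _, .tru, _ => ⟨0, .tru⟩
  | _, .fls, _ => ⟨0, .fls⟩
  | _, .star, _ => ⟨1, .charFm_self (n := 1) (P := .unit) true⟩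
  | _, .and φ ψ, h =>
    have ⟨n, hn⟩ := exists_decidedAt h.1
    have ⟨m, hm⟩ := exists_decidedAt h.2
    ⟨max n m, .and (hn.mono (le_max_left n m)) (hm.mono (le_max_right n m))⟩
  | _, .mod m φ, h => have ⟨n, hn⟩ := exists_decidedAt (φ := φ) h; ⟨n + 1, hn.mod m⟩
  | _, .imp ψ φ, h =>
    have ⟨n, hn⟩ := exists_decidedAt h.1
    have ⟨m, hm⟩ := exists_decidedAt h.2
    ⟨max n m + 1, .imp (hn.mono (le_max_left n m)) (hm.mono (le_max_right n m))⟩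

/-! ## Open properties defined by conjunctive formulae -/

namespace Fm.IsConj

variable {P Q : PTy} {φ : Fm 0 [] P}

theorem exists_equi_charFm (hφ : φ.IsConj) {x : dom P} (hx : x ∈ φ.den) :
    ∃ n a, a ≤ x.seq (n + 1) ∧ Equi φ (charFm (n + 1) P a) := by
  obtain ⟨n, hn⟩ := hφ.exists_decidedAt
  rcases hn.mono n.le_succ with h | ⟨a, ha⟩
  · exact absurd hx (Set.eq_empty_iff_forall_notMem.1 h.den_eq x)
  · exact ⟨n, a, mem_charFm.1 (ha.den_eq.le hx), ha⟩

theorem isUpperSet_den (hφ : φ.IsConj) : IsUpperSet φ.den := fun x y hxy hx => by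
  obtain ⟨n, a, hax, ha⟩ := hφ.exists_equi_charFm hx
  exact ha.den_eq.ge (mem_charFm.2 (hax.trans (hxy (n + 1))))

theorem exists_map_emb_mem_den (hφ : φ.IsConj) {f : SHom (dom Q) (dom P)} {x : dom Q}
    (hx : f x ∈ φ.den) : ∃ m, f (Lim.emb (tyChain Q) m (x.seq m)) ∈ φ.den := by
  obtain ⟨n, a, hax, ha⟩ := hφ.exists_equi_charFm hx
  have : Finite ((tyChain P).X (n + 1)) := finite_approx (n + 1) P
  obtain ⟨m, hm⟩ := Lim.exists_seq_map_emb_eq (n := n + 1) f x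
  exact ⟨m, ha.den_eq.ge (mem_charFm.2 (hax.trans hm.ge))⟩

theorem ded_of_emb_mem_den (hφ : φ.IsConj) {n : ℕ} {a : approx n P}
    (h : Lim.emb (tyChain P) n a ∈ φ.den) : Ded .neutral (charFm n P a) φ := by
  obtain ⟨m, b, hb, hφb⟩ := hφ.exists_equi_charFm h
  exact (Ded.charFm_of_emb_le (Lim.emb_le_iff.2 hb)).cut hφb.mpr

theorem ded_of_bot_mem_den (hφ : φ.IsConj) (h : ⊥ ∈ φ.den) : Ded .neutral .tru φ :=
  hφ.ded_of_emb_mem_den (n := 0) (a := ⊥) (hφ.isUpperSet_den bot_le h)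

end Fm.IsConj

/-! ## Typing in contexts of finite elements -/

/-- The refinement of a pure type by a conjunctive formula. -/
def conjTy {P : PTy} (φ : Fm 0 [] P) (hφ : φ.IsConj) : RTy P :=
  .refine φ ⟨.neutral, .of_isConj hφ⟩

/-- The refinement type of the elements above a finite element. -/
def charTy {P : PTy} (n : ℕ) (a : approx n P) : RTy P :=
  conjTy (charFm n P a) (charFm_isConj n P a)

/-- A choice of a finite element of each type of a pure context. -/
inductive FinCtx : List PTy → Type
  | nil : FinCtx []
  | cons {P : PTy} {Γ : List PTy} (n : ℕ) (a : approx n P) (Ψ : FinCtx Γ) : FinCtx (P :: Γ)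

namespace FinCtx

/-- The context whose types consist of the elements above the chosen ones. -/
def toRCtx : {Γ : List PTy} → FinCtx Γ → RCtx
  | _, .nil => []
  | _, .cons (P := P) n a Ψ => ⟨P, charTy n a⟩ :: Ψ.toRCtx

/-- The tuple of the chosen elements, which is the least one of the types of the context. -/
def point : {Γ : List PTy} → FinCtx Γ → ctxDom Γ
  | _, .nil => PUnit.unit
  | _, .cons (P := P) (Γ := Γ) n a Ψ =>
    ((Lim.emb (tyChain P) n a, Ψ.point) : dom P × ctxDom Γ)

theorem und_toRCtx {Γ : List PTy} (Ψ : FinCtx Γ) : Ψ.toRCtx.und = Γ := by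
  induction Ψ with
  | nil => rfl
  | cons n a Ψ ih => exact congrArg (List.cons _) ih

/-- A pure typing, transported along `und_toRCtx`. -/
def typing {Γ : List PTy} {M : Tm} {P : PTy} (Ψ : FinCtx Γ) (d : PTyping Γ M P) :
    PTyping Ψ.toRCtx.und M P :=
  Ψ.und_toRCtx.symm ▸ d

theorem exists_var {Γ : List PTy} {P : PTy} (v : Var Γ P) (Ψ : FinCtx Γ) :
    ∃ (n : ℕ) (a : approx n P) (w : Var Ψ.toRCtx ⟨P, charTy n a⟩),
      w.idx = v.idx ∧ v.sem Ψ.point = Lim.emb (tyChain P) n a := by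
  induction v with
  | zero =>
    cases Ψ with
    | cons n a Ψ => exact ⟨n, a, .zero, rfl, rfl⟩
  | succ v ih =>
    cases Ψ with
    | cons _ _ Ψ =>
      obtain ⟨n, a, w, hidx, hsem⟩ := ih Ψ
      exact ⟨n, a, .succ w, congrArg (· + 1) hidx, hsem⟩

end FinCtx

theorem CtxSub.refl (Γ : RCtx) : CtxSub Γ Γ := by
  induction Γ with
  | nil => exact .nil
  | cons A Γ ih => exact .cons .refl ih

theorem CtxSub.und_eq {Γ Γ' : RCtx} (h : CtxSub Γ Γ') : Γ.und = Γ'.und := by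
  induction h with
  | nil => rfl
  | cons _ _ ih => exact congrArg (List.cons _) ih

namespace RTyping

variable {Γ : RCtx} {M : Tm} {P Q : PTy} {φ ψ : Fm 0 [] P}

theorem weaken {hφ : φ.IsConj} {hψ : ψ.IsConj} (h : RTyping Γ M (conjTy φ hφ))
    (hφψ : Ded .neutral φ ψ) : RTyping Γ M (conjTy ψ hψ) :=
  .sub (.refl Γ) h (.ded hφψ)

theorem of_ded_tru {hφ : φ.IsConj} (d : PTyping Γ.und M P) (h : Ded .neutral .tru φ) :
    RTyping Γ M (conjTy φ hφ) :=
  .sub (.refl Γ) (.pure d) (.trans (.pureTru (h := ⟨.neutral, .tru⟩)) (.ded h))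

theorem bigAnd {l : List (Fm 0 [] P)} {hl : (Fm.bigAnd l).IsConj} (d : PTyping Γ.und M P)
    (h : ∀ φ ∈ l, ∃ hφ, RTyping Γ M (conjTy φ hφ)) : RTyping Γ M (conjTy (Fm.bigAnd l) hl) := by
  induction l with
  | nil => exact of_ded_tru d (.id .tru)
  | cons φ l ih =>
    obtain ⟨_, hφ⟩ := h φ List.mem_cons_self
    exact .and hφ (ih (hl := hl.2) fun χ hχ => h χ (List.mem_cons_of_mem φ hχ))

theorem imps {ι : Type} [Finite ι] {ψ : ι → Fm 0 [] Q} {φ : ι → Fm 0 [] P}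
    {hψ : ∀ i, (ψ i).IsConj} {hφ : ∀ i, (φ i).IsConj} (d : PTyping Γ.und M (.arr Q P))
    (h : ∀ i, RTyping Γ M (.arr (conjTy (ψ i) (hψ i)) (conjTy (φ i) (hφ i)))) :
    RTyping Γ M (conjTy (Fm.imps ψ φ) (.imps hψ hφ)) :=
  bigAnd d (List.forall_mem_map.2 fun i _ =>
    ⟨⟨hψ i, hφ i⟩, .sub (.refl Γ) (h i) .arrL⟩)

end RTyping

/-- Completeness of typing for the term `M` in contexts of finite elements: each conjunctive formula
that holds of the value of `M` at the chosen elements is derivable. -/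
def Typable {Γ : List PTy} {M : Tm} {P : PTy} (d : PTyping Γ M P) : Prop :=
  ∀ (Ψ : FinCtx Γ) (φ : Fm 0 [] P) (hφ : φ.IsConj), d.sem Ψ.point ∈ φ.den →
    RTyping Ψ.toRCtx M (conjTy φ hφ)

namespace Typable

variable {Γ : List PTy} {M N : Tm} {P Q R : PTy}

theorem of_charTy {d : PTyping Γ M P}
    (h : ∀ (Ψ : FinCtx Γ) (n : ℕ) (a : approx (n + 1) P), a ≤ (d.sem Ψ.point).seq (n + 1) →
      RTyping Ψ.toRCtx M (charTy (n + 1) a)) : Typable d := fun Ψ φ hφ hφd => by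
  obtain ⟨n, a, had, ha⟩ := hφ.exists_equi_charFm hφd
  exact (h Ψ n a had).weaken ha.mpr

theorem charTy {d : PTyping Γ M P} (h : Typable d) {Ψ : FinCtx Γ} {n : ℕ} {a : approx n P}
    (ha : a ≤ (d.sem Ψ.point).seq n) : RTyping Ψ.toRCtx M (charTy n a) :=
  h Ψ _ (charFm_isConj n P a) (mem_charFm.2 ha)

theorem exists_hypothesis {d : PTyping (Q :: Γ) M P} (h : Typable d) {Ψ : FinCtx Γ} {x : dom Q}
    {φ : Fm 0 [] P} (hφ : φ.IsConj)
    (hx : d.sem ((x, Ψ.point) : dom Q × ctxDom Γ) ∈ φ.den) :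
    ∃ m, RTyping (⟨Q, FPC.charTy m (x.seq m)⟩ :: Ψ.toRCtx) M (conjTy φ hφ) := by
  obtain ⟨m, hm⟩ := hφ.exists_map_emb_mem_den
    (f := SHom.curry (d.sem : SHom (dom Q × ctxDom Γ) (dom P)) Ψ.point) hx
  exact ⟨m, h (.cons m (x.seq m) Ψ) φ hφ hm⟩

theorem var (v : Var Γ P) : Typable (.var v) := fun Ψ φ hφ hv => by
  obtain ⟨n, a, w, hidx, hsem⟩ := Ψ.exists_var v
  exact hidx ▸ RTyping.weaken (.var w) (hφ.ded_of_emb_mem_den (hsem ▸ hv))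

theorem star : Typable (.star : PTyping Γ .star .unit) :=
  of_charTy fun Ψ n a _ => by
    have htop : RTyping Ψ.toRCtx .star (FPC.charTy (P := .unit) (n + 1) true) := .star
    exact htop.weaken (.charFm_antitone (P := .unit) (Bool.le_true a))

theorem pair {d : PTyping Γ M P} {d' : PTyping Γ N Q} (h : Typable d) (h' : Typable d') :
    Typable (d.pair d') :=
  of_charTy fun _ _ _ ha => .sub (.refl _) (.pair (h.charTy ha.1) (h'.charTy ha.2)) .prodL

theorem fst {d : PTyping Γ M (.prod P Q)} (h : Typable d) : Typable d.fst :=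
  fun Ψ φ hφ hd => .proj₁ (h Ψ (φ.mod .fst) hφ hd)

theorem snd {d : PTyping Γ M (.prod P Q)} (h : Typable d) : Typable d.snd :=
  fun Ψ φ hφ hd => .proj₂ (h Ψ (φ.mod .snd) hφ hd)

theorem lam {d : PTyping (Q :: Γ) M P} (h : Typable d) : Typable d.lam :=
  of_charTy fun Ψ n _ hf =>
    .imps (Ψ.typing d.lam) fun x => .lam (h.charTy (Ψ := .cons n x Ψ) (hf x))

theorem app {d : PTyping Γ M (.arr Q P)} {d' : PTyping Γ N Q} (h : Typable d)
    (h' : Typable d') : Typable (d.app d') := fun Ψ φ hφ hd => by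
  let f : SHom (dom Q) (dom P) := (arrIso Q P).symm (d.sem Ψ.point)
  let x : dom Q := d'.sem Ψ.point
  obtain ⟨m, hm⟩ := hφ.exists_map_emb_mem_den (f := f) (x := x) hd
  have himp := h Ψ (.imp (charFm m Q (x.seq m)) φ) ⟨charFm_isConj m Q _, hφ⟩ fun _ hz =>
    hφ.isUpperSet_den (f.mono (Lim.emb_le_iff.2 (mem_charFm.1 hz))) hm
  exact .app (.sub (.refl _) himp .arrR) (h'.charTy le_rfl)

theorem fix {d : PTyping (P :: Γ) M P} (h : Typable d) : Typable d.fix :=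
  of_charTy fun Ψ n a ha => by
    let f : SHom (dom P) (dom P) := SHom.curry (d.sem : SHom (dom P × ctxDom Γ) (dom P)) Ψ.point
    have typing_of_iter (k : ℕ) : ∀ (φ : Fm 0 [] P) (hφ : φ.IsConj),
        SHom.iter (dom P) k f ∈ φ.den → RTyping Ψ.toRCtx (.fix M) (conjTy φ hφ) := by
      induction k with
      | zero => exact fun φ hφ hk => .of_ded_tru (Ψ.typing d.fix) (hφ.ded_of_bot_mem_den hk)
      | succ k ih =>
        intro φ hφ hk
        obtain ⟨m, hm⟩ := h.exists_hypothesis (x := SHom.iter (dom P) k f) hφ hk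
        exact .fix (ih _ (charFm_isConj m P _) (mem_charFm.2 le_rfl)) hm
    have : Finite ((tyChain P).X (n + 1)) := finite_approx (n + 1) P
    obtain ⟨k, hk⟩ := exists_apply_eq_of_isLUB_range (Lim.proj (tyChain P) (n + 1)).cont
      (SHom.iter_mono f) (SHom.isLUB_lfp f)
    exact typing_of_iter k _ _ (mem_charFm.2 (ha.trans hk.ge))

theorem fold {P : Ty 1} {d : PTyping Γ M P.unfold} (h : Typable d) : Typable d.fold :=
  of_charTy fun _ _ _ ha => .fold (h.charTy ha)

theorem unfold {P : Ty 1} {d : PTyping Γ M (.mu P)} (h : Typable d) : Typable d.unfold :=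
  fun Ψ φ hφ hd => .unfold (h Ψ (φ.mod .fold) hφ hd)

theorem inl {d : PTyping Γ M P} (h : Typable d) : Typable (d.inl (Q := Q)) :=
  of_charTy fun Ψ _ a ha => match a, ha with
    | .bot, _ => .of_ded_tru (Ψ.typing d.inl) (.id .tru)
    | .inl _, ha => .inl (h.charTy ha)

theorem inr {d : PTyping Γ M Q} (h : Typable d) : Typable (d.inr (P := P)) :=
  of_charTy fun Ψ _ a ha => match a, ha with
    | .bot, _ => .of_ded_tru (Ψ.typing d.inr) (.id .tru)
    | .inr _, ha => .inr (h.charTy ha)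

theorem case {N₁ N₂ : Tm} {d : PTyping Γ M (.sum P Q)} {d₁ : PTyping (P :: Γ) N₁ R}
    {d₂ : PTyping (Q :: Γ) N₂ R} (h : Typable d) (h₁ : Typable d₁) (h₂ : Typable d₂) :
    Typable (d.case d₁ d₂) := fun Ψ φ hφ hd => by
  let f₁ : SHom (dom P) (dom R) := SHom.curry (d₁.sem : SHom (dom P × ctxDom Γ) (dom R)) Ψ.point
  let f₂ : SHom (dom Q) (dom R) := SHom.curry (d₂.sem : SHom (dom Q × ctxDom Γ) (dom R)) Ψ.point
  have hcase : LSum.elim f₁ f₂ ((sumIso P Q).symm (d.sem Ψ.point)) ∈ φ.den := hd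
  obtain ⟨z, hz⟩ := (sumIso P Q).surjective (d.sem Ψ.point)
  rw [← hz, OrderIso.symm_apply_apply] at hcase
  cases z with
  | bot => exact .of_ded_tru (Ψ.typing (d.case d₁ d₂)) (hφ.ded_of_bot_mem_den hcase)
  | inl x =>
    obtain ⟨m, hm⟩ := h₁.exists_hypothesis hφ hcase
    exact .case₁ (h Ψ ((charFm m P (x.seq m)).mod .inl) (charFm_isConj _ _ _)
      ⟨x, mem_charFm.2 le_rfl, hz⟩) hm ((FinCtx.cons 0 ⊥ Ψ).typing d₂)
  | inr x =>
    obtain ⟨m, hm⟩ := h₂.exists_hypothesis hφ hcase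
    exact .case₂ (h Ψ ((charFm m Q (x.seq m)).mod .inr) (charFm_isConj _ _ _)
      ⟨x, mem_charFm.2 le_rfl, hz⟩) ((FinCtx.cons 0 ⊥ Ψ).typing d₁) hm

end Typable

theorem PTyping.typable {Γ : List PTy} {M : Tm} {P : PTy} (d : PTyping Γ M P) : Typable d := by
  induction d with
  | var v => exact .var v
  | star => exact .star
  | pair _ _ h h' => exact h.pair h'
  | fst _ h => exact h.fst
  | snd _ h => exact h.snd
  | lam _ h => exact h.lam
  | app _ _ h h' => exact h.app h'
  | fix _ h => exact h.fix
  | fold _ h => exact h.fold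
  | unfold _ h => exact h.unfold
  | inl _ h => exact h.inl
  | inr _ h => exact h.inr
  | case _ _ _ h h₁ h₂ => exact h.case h₁ h₂

/-! ## Reduction to contexts of finite elements -/

theorem RTy.IsConj.exists_conjTy {P : PTy} {T : RTy P} (hT : T.IsConj) :
    ∃ (φ : Fm 0 [] P) (hφ : φ.IsConj),
      Sub T (conjTy φ hφ) ∧ Sub (conjTy φ hφ) T ∧ T.sem = φ.den := by
  induction T with
  | pure P => exact ⟨.tru, trivial, .pureTru, .toPure, rfl⟩
  | refine φ h => exact ⟨φ, hT, .refl, .refl, rfl⟩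
  | prod T U ihT ihU =>
    obtain ⟨φ, hφ, toφ, ofφ, hTφ⟩ := ihT hT.1
    obtain ⟨ψ, hψ, toψ, ofψ, hUψ⟩ := ihU hT.2
    exact ⟨(φ.mod .fst).and (ψ.mod .snd), ⟨hφ, hψ⟩, (Sub.prod toφ toψ).trans .prodL,
      Sub.trans .prodR (.prod ofφ ofψ), by rw [RTy.sem, hTφ, hUψ]; rfl⟩
  | arr U T ihU ihT =>
    obtain ⟨ψ, hψ, toψ, ofψ, hUψ⟩ := ihU hT.1
    obtain ⟨φ, hφ, toφ, ofφ, hTφ⟩ := ihT hT.2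
    exact ⟨.imp ψ φ, ⟨hψ, hφ⟩, (Sub.arr ofψ toφ).trans .arrL, Sub.trans .arrR (.arr toψ ofφ),
      by rw [RTy.sem, hTφ, hUψ]; rfl⟩

theorem RTy.IsConj.sub_fls_or_sub_charTy {P : PTy} {T : RTy P} (hT : T.IsConj) :
    Sub T (conjTy .fls trivial) ∨
      ∃ (n : ℕ) (a : approx n P), Sub T (charTy n a) ∧ Lim.emb (tyChain P) n a ∈ T.sem := by
  obtain ⟨φ, hφ, hsub, -, hsem⟩ := hT.exists_conjTy
  obtain ⟨n, h | ⟨a, ha⟩⟩ := hφ.exists_decidedAt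
  · exact .inl (hsub.trans (.ded h.mp))
  · refine .inr ⟨n, a, hsub.trans (.ded ha.mp), ?_⟩
    rw [hsem, ha.den_eq]
    exact emb_mem_den_charFm a

theorem RCtx.IsConj.ctxSub_fls_or_ctxSub_finCtx {Γ : RCtx} (hΓ : Γ.IsConj) :
    (∃ (Γ₁ : RCtx) (Q : PTy) (Γ₂ : RCtx),
      CtxSub Γ (Γ₁ ++ ⟨Q, conjTy .fls trivial⟩ :: Γ₂)) ∨
    ∃ Ψ : FinCtx Γ.und, CtxSub Γ Ψ.toRCtx ∧ Ψ.point ∈ Γ.sem := by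
  induction Γ with
  | nil => exact .inr ⟨.nil, .nil, trivial⟩
  | cons A Γ ih =>
    obtain ⟨hT, hΓ⟩ := List.forall_mem_cons.1 hΓ
    rcases hT.sub_fls_or_sub_charTy with h | ⟨n, a, hsub, ha⟩
    · exact .inl ⟨[], A.1, Γ, .cons h (.refl Γ)⟩
    rcases ih hΓ with ⟨Γ₁, Q, Γ₂, h⟩ | ⟨Ψ, hΨ, hmem⟩
    · exact .inl ⟨A :: Γ₁, Q, Γ₂, .cons .refl h⟩
    · exact .inr ⟨.cons n a Ψ, .cons hsub hΨ, ha, hmem⟩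

end

end FPC

theorem mainTheorem2 (Γ : FPC.RCtx) (M : FPC.Tm) {P : FPC.PTy} (T : FPC.RTy P)
    (hΓ : FPC.RCtx.IsConj Γ) (hT : T.IsConj) (h : FPC.Sound Γ M T) : FPC.RTyping Γ M T := by
  obtain ⟨d, hsound⟩ := h
  rcases hΓ.ctxSub_fls_or_ctxSub_finCtx with ⟨Γ₁, Q, Γ₂, hsub⟩ | ⟨Ψ, hsub, hΨ⟩
  · exact .sub hsub (.fls (hsub.und_eq ▸ d)) .refl
  · obtain ⟨φ, hφ, -, hφT, hsem⟩ := hT.exists_conjTy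
    exact .sub hsub (d.typable Ψ φ hφ (hsem ▸ hsound Ψ.point hΨ)) hφT
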